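/- Let $K$ be a field of characteristic zero, let $n\ge 0$ and $m=(m_1,\ldots,m_n)\in\mathbb{N}^n$, where $\mathbb{N}=\{0,1,2,\ldots\}$. Let $$A(m)=\bigotimes_{i=1}^n A(m_i)\subseteq K[x_1,\ldots,x_n],\qquad A(m_i)=K+\sum_{j\ge m_i}Kx_i^j\subseteq K[x_i],$$ be the generalized multi-cusp algebra. Let $\mathcal{D}(A(m))\subseteq \operatorname{End}_K(A(m))$ be its ring of $K$-linear differential operators, i.e. $\mathcal{D}(A(m))=\bigcup_{k\ge 0}\mathcal{D}_k$, where $\mathcal{D}_0=\{u : [a,u]=0 \text{ for all } a\in A(m)\}$ and $\mathcal{D}_{k+1}=\{u : [a,u]\in\mathcal{D}_k\text{ for all }a\in A(m)\}$ (elements of $A(m)$ are regarded as multiplication operators). Then: 1. $\mathcal{D}(A(m))$ is central, i.e. its centre is $K$; 2. $\mathcal{D}(A(m))$ is a simple ring; 3. $\mathcal{D}(A(m))$ is $\mathbb{Z}^n$-graded: $\mathcal{D}(A(m))=\bigoplus_{\alpha\in\mathbb{Z}^n}\mathcal{D}(A(m))_{[\alpha]}$ and $\mathcal{D}(A(m))_{[\alpha]}\mathcal{D}(A(m))_{[\beta]}\subseteq\mathcal{D}(A(m))_{[\alpha+\beta]}$,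 where $\mathcal{D}(A(m))_{[\alpha]}$ consists of the differential operators that map each monomial $x^\beta\in A(m)$ into $Kx^{\beta+\alpha}$ (to $0$ if $\beta+\alpha\notin\mathbb{N}^n$); 4. $\mathcal{D}(A(m))$ is a finitely generated $K$-algebra; 5. $\mathcal{D}(A(m))$ is left and right Noetherian; 6. $\mathcal{D}(A(m))$ is a domain; 7. the Gelfand–Kirillov dimension of $\mathcal{D}(A(m))$ over $K$ is $2n$, where the Gelfand–Kirillov dimension of a nonzero $K$-algebra $R$ is $\sup_V\limsup_{k\to\infty}\frac{\log\dim_K V^k}{\log k}$, with $V$ running over the finite dimensional subspaces of $R$ that contain $1$. -/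

import Mathlib

/-! ### Differential operators on a commutative algebra (Grothendieck's definition) -/

/-- `IsDiffOp K A k u` : the `K`-linear endomorphism `u` of the commutative `K`-algebra `A` is a
differential operator of order at most `k`, that is, `[a, u] = a u - u a` vanishes for all `a ∈ A`
(if `k = 0`), or is a differential operator of order at most `k - 1` for all `a ∈ A` (if `k > 0`).
Here `a ∈ A` is identified with the multiplication operator `Algebra.lmul K A a`. -/
def IsDiffOp (K A : Type*) [CommRing K] [CommRing A] [Algebra K A] :
    ℕ → Module.End K A → Prop
  | 0, u => ∀ a : A, Algebra.lmul K A a * u - u * Algebra.lmul K A a = 0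
  | k + 1, u => ∀ a : A, IsDiffOp K A k (Algebra.lmul K A a * u - u * Algebra.lmul K A a)

section DiffOp

variable {K A : Type*} [CommRing K] [CommRing A] [Algebra K A]

theorem IsDiffOp.zero : ∀ k : ℕ, IsDiffOp K A k 0
  | 0 => fun a => by rw [mul_zero, zero_mul, sub_zero]
  | k + 1 => fun a => by rw [mul_zero, zero_mul, sub_zero]; exact IsDiffOp.zero k

theorem IsDiffOp.add : ∀ {k : ℕ} {u v : Module.End K A},
    IsDiffOp K A k u → IsDiffOp K A k v → IsDiffOp K A k (u + v)
  | 0, _, _, hu, hv => fun a => by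
    rw [mul_add, add_mul, add_sub_add_comm, hu a, hv a, add_zero]
  | _ + 1, _, _, hu, hv => fun a => by
    rw [mul_add, add_mul, add_sub_add_comm]; exact (hu a).add (hv a)

theorem IsDiffOp.succ : ∀ {k : ℕ} {u : Module.End K A},
    IsDiffOp K A k u → IsDiffOp K A (k + 1) u
  | 0, _, hu => fun a => by rw [hu a]; exact IsDiffOp.zero 0
  | _ + 1, _, hu => fun a => (hu a).succ

theorem IsDiffOp.mono {k l : ℕ} (h : k ≤ l) {u : Module.End K A}
    (hu : IsDiffOp K A k u) : IsDiffOp K A l u := by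
  induction h with
  | refl => exact hu
  | step _ ih => exact ih.succ

theorem IsDiffOp.lmul (a : A) : IsDiffOp K A 0 (Algebra.lmul K A a) := fun b => by
  rw [← map_mul, ← map_mul, mul_comm, sub_self]

theorem commutator_mul {R : Type*} [Ring R] (a u v : R) :
    a * (u * v) - u * v * a = (a * u - u * a) * v + u * (a * v - v * a) := by
  noncomm_ring

theorem IsDiffOp.mul : ∀ (N k l : ℕ), k + l = N → ∀ {u v : Module.End K A},
    IsDiffOp K A k u → IsDiffOp K A l v → IsDiffOp K A (k + l) (u * v) := by
  intro N
  induction N with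
  | zero =>
    intro k l h u v hu hv
    obtain ⟨rfl, rfl⟩ : k = 0 ∧ l = 0 := by omega
    intro a
    rw [commutator_mul, hu a, hv a, zero_mul, mul_zero, add_zero]
  | succ N ih =>
    intro k l h u v hu hv
    rw [h]
    intro a
    rw [commutator_mul]
    refine IsDiffOp.add ?_ ?_
    · cases k with
      | zero => rw [hu a, zero_mul]; exact IsDiffOp.zero _
      | succ k =>
        have := ih k l (by omega) (hu a) hv
        exact this.mono (by omega)
    · cases l with
      | zero => rw [hv a, mul_zero]; exact IsDiffOp.zero _
      | succ l =>
        have := ih k l (by omega) hu (hv a)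
        exact this.mono (by omega)

end DiffOp

/-- The ring `𝒟(A)` of (`K`-linear) differential operators on the commutative `K`-algebra `A`:
the subalgebra of `End_K(A)` of all operators of some finite order. -/
def diffOps (K A : Type*) [CommRing K] [CommRing A] [Algebra K A] :
    Subalgebra K (Module.End K A) where
  carrier := {u | ∃ k : ℕ, IsDiffOp K A k u}
  mul_mem' := by
    rintro u v ⟨k, hu⟩ ⟨l, hv⟩
    exact ⟨k + l, IsDiffOp.mul _ k l rfl hu hv⟩
  add_mem' := by
    rintro u v ⟨k, hu⟩ ⟨l, hv⟩
    exact ⟨max k l, (hu.mono (le_max_left _ _)).add (hv.mono (le_max_right _ _))⟩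
  algebraMap_mem' := fun c => ⟨0, by
    have h : algebraMap K (Module.End K A) c = Algebra.lmul K A (algebraMap K A c) :=
      ((Algebra.lmul K A).commutes c).symm
    rw [h]
    exact IsDiffOp.lmul _⟩

/-- The ring structure of the subalgebra `𝒟(A)` of `End_K(A)`. -/
instance diffOps.instRing (K A : Type*) [CommRing K] [CommRing A] [Algebra K A] :
    Ring (diffOps K A) :=
  (diffOps K A).toRing

/-! ### Generalized multi-cusp algebras -/

/-- The generalized cusp algebra `A(k) = K + ∑_{j ≥ k} K x^j ⊆ K[x]`: the polynomials without
terms of degree `j` for `0 < j < k`. -/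
def cuspAlgebra (K : Type*) [Field K] (k : ℕ) : Subalgebra K (Polynomial K) where
  carrier := {p | ∀ j : ℕ, 0 < j → j < k → p.coeff j = 0}
  mul_mem' := by
    intro p q hp hq j h0 hk
    rw [Polynomial.coeff_mul]
    refine Finset.sum_eq_zero fun x hx => ?_
    have hx' : x.1 + x.2 = j := Finset.HasAntidiagonal.mem_antidiagonal.1 hx
    rcases Nat.eq_zero_or_pos x.1 with h | h
    · rw [hq x.2 (by omega) (by omega), mul_zero]
    · rw [hp x.1 h (by omega), zero_mul]
  add_mem' := by
    intro p q hp hq j h0 hk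
    rw [Polynomial.coeff_add, hp j h0 hk, hq j h0 hk, add_zero]
  algebraMap_mem' := by
    intro c j h0 hk
    rw [Polynomial.algebraMap_apply, Algebra.algebraMap_self, RingHom.id_apply,
      Polynomial.coeff_C, if_neg (by omega)]

/-- The generalized multi-cusp algebra `A(m) = A(m₁) ⊗ ⋯ ⊗ A(mₙ)`, as a subalgebra of
`K[x₁, …, xₙ] = K[x₁] ⊗ ⋯ ⊗ K[xₙ]`: the subalgebra generated by the copies of the algebras
`A(mᵢ) ⊆ K[xᵢ]`. -/
noncomputable def multiCuspAlgebra (K : Type*) [Field K] {n : ℕ} (m : Fin n → ℕ) :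
    Subalgebra K (MvPolynomial (Fin n) K) :=
  ⨆ i : Fin n, (cuspAlgebra K (m i)).map (Polynomial.aeval (MvPolynomial.X i))

/-- The ring of differential operators `𝒟(A(m))`. -/
noncomputable abbrev multiCuspDiffOps (K : Type*) [Field K] {n : ℕ} (m : Fin n → ℕ) :
    Subalgebra K (Module.End K (multiCuspAlgebra K m)) :=
  diffOps K (multiCuspAlgebra K m)

/-- The component of degree `α ∈ ℤⁿ` of `𝒟(A(m))`: the differential operators that map, for every
`β`, each scalar multiple of the monomial `x^β` lying in `A(m)` to a scalar multiple of
`x^(β + α)` (to zero, if `β + α ∉ ℕⁿ`). -/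
def multiCuspDegree (K : Type*) [Field K] {n : ℕ} (m : Fin n → ℕ) (α : Fin n → ℤ) :
    Submodule K (multiCuspDiffOps K m) where
  carrier := {u | ∀ (β : Fin n →₀ ℕ) (a : multiCuspAlgebra K m),
    (a : MvPolynomial (Fin n) K).support ⊆ {β} →
      ∀ γ ∈ ((u : Module.End K (multiCuspAlgebra K m)) a : MvPolynomial (Fin n) K).support,
        ∀ i, (γ i : ℤ) = β i + α i}
  add_mem' := by
    intro u v hu hv β a ha γ hγ
    rcases Finset.mem_union.1 (MvPolynomial.support_add hγ) with h | h
    · exact hu β a ha γ h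
    · exact hv β a ha γ h
  zero_mem' := by
    intro β a _ γ hγ
    simp at hγ
  smul_mem' := by
    intro c u hu β a ha γ hγ
    exact hu β a ha γ (MvPolynomial.support_smul hγ)

/-! ### Gelfand–Kirillov dimension -/

/-- The Gelfand–Kirillov dimension of a (nonzero) algebra `R` over a field `K`:
`sup_V limsup_{k → ∞} log (dim_K V^k) / log k`, where `V` runs through the finite dimensional
subspaces of `R` that contain `1`, and `V^k` is the span of all products of `k` elements
of `V`. -/
noncomputable def gkDim (K R : Type*) [Field K] [Ring R] [Algebra K R] : EReal :=
  ⨆ V : {V : Submodule K R // V.FG ∧ (1 : R) ∈ V},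
    Filter.limsup
      (fun k : ℕ => ((Real.log (Module.finrank K ↥(V.1 ^ k)) / Real.log k : ℝ) : EReal))
      Filter.atTop

/-! Let `S` be the set of exponents of the monomials in `A(m)`. An operator `u` is determined by its
coefficient functions `c_α(β)`, the coefficient of `x^(β + α)` in `u (x^β)`. Commuting with `x^s`
turns `c_α` into `c_α(β) - c_α(β + s)`, so a differential operator has polynomial coefficient
functions, nonzero for finitely many `α` only (`isDiffOp_opCoeff_structure`). Conversely, a
polynomial `f` is a coefficient function of degree `α` as soon as it vanishes at every `β ∈ S` with
`β + α ∉ S` (`Admissible`, `isDiffOp_cuspOp`). Thus `𝒟(A(m))` is the direct sum of spaces `x^α I_α`,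
where `I_α` is an ideal of `K[θ₁, …, θₙ]` and `θᵢ` is the Euler operator. This gives the grading.

Since `x^α θ^δ` has the same top part as `x^(α + δ) ∂^δ`, it receives the exponent `(α + δ, δ) ∈
ℤ^(2n)`. These exponents are ordered by total weight, then lexicographically. A product shifts the
arguments of symbols, which only creates lower terms, so leading exponents add and leading
coefficients multiply (`expCoeff_mul_add`). Leading exponents are nonnegative by the combinatorial
Nullstellensatz (`nonneg_of_leading`), and for one `M > 0` all vectors `M eⱼ` occur: `xᵢ^M` and a
lowering operator of degree `-M` in `xᵢ` realise them (`exists_lead_single`).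

From these facts alone, collected in `LeadingExponents`, it follows that the ring is a domain, is
Noetherian on the left (on the right by passing to the opposite ring), is finitely generated, and
has Gelfand–Kirillov dimension `2n`. The Noetherian property and finite generation are Gröbner basis
arguments resting on Dickson's lemma; the dimension comes from counting lattice points.

A central element commutes with `A(m)`, hence is a multiplication, and commutes with the `θᵢ`, hence
is a scalar. A nonzero ideal contains a nonzero multiplication operator (by commutators), then a
monomial (by Euler operators), and finally `1`, because for the lowering operator `L` with symbol
`p` the products `xᵢ^N L = p(θᵢ)` and `L xᵢ^N = p(θᵢ + N)` are coprime. -/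

/-- Leading exponents for an algebra `R`: every element of `R` has finitely many coefficients,
indexed by `ι → ℤ`, and the highest nonzero one with respect to a linear order refining the total
weight is multiplicative. The exponents of nonzero elements are nonnegative, and contain all
multiples of the vectors `period • eᵢ`. -/
structure LeadingExponents (K R ι Γ : Type*) [Field K] [Ring R] [Algebra K R] [Fintype ι]
    [DecidableEq ι] [LinearOrder Γ] where
  coeff : R →ₗ[K] ((ι → ℤ) → K)
  ord : (ι → ℤ) → Γ
  coeff_injective : Function.Injective coeff
  finite_support : ∀ u, {g | coeff u g ≠ 0}.Finite
  ord_injective : Function.Injective ord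
  ord_lt : ∀ g h : ι → ℤ, ∑ i, g i < ∑ i, h i → ord g < ord h
  coeff_mul_of_lt : ∀ u v a b, (∀ g, ord a < ord g → coeff u g = 0) →
    (∀ g, ord b < ord g → coeff v g = 0) → ∀ g, ord (a + b) < ord g → coeff (u * v) g = 0
  coeff_mul_add : ∀ u v a b, (∀ g, ord a < ord g → coeff u g = 0) →
    (∀ g, ord b < ord g → coeff v g = 0) → coeff (u * v) (a + b) = coeff u a * coeff v b
  nonneg : ∀ u a, coeff u a ≠ 0 → (∀ g, ord a < ord g → coeff u g = 0) → 0 ≤ a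
  period : ℕ
  period_pos : 0 < period
  exists_single : ∀ i, ∃ u, coeff u (Pi.single i (period : ℤ)) ≠ 0 ∧
    ∀ g, ord (Pi.single i (period : ℤ)) < ord g → coeff u g = 0

/-- A set of natural vectors has a finite subset from which all others are obtained by adding
`M` times natural vectors. -/
theorem exists_finite_basis_of_period {ι : Type*} [Fintype ι] {M : ℕ} (hM : 0 < M)
    (E : Set (ι → ℤ)) (hE : ∀ a ∈ E, 0 ≤ a) :
    ∃ B : Set (ι → ℤ), B.Finite ∧ B ⊆ E ∧
      ∀ a ∈ E, ∃ b ∈ B, ∃ q : ι → ℕ, a = b + fun i => (M : ℤ) * q i := by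
  classical
  -- Division with remainder by `M` in each coordinate. Within a residue class `r` the set `F r` of
  -- quotients has finitely many minimal elements, by Dickson's lemma.
  let e : (ι → Fin M) → (ι → ℕ) → (ι → ℤ) := fun r q i => (r i : ℤ) + M * q i
  let F : (ι → Fin M) → Set (ι → ℕ) := fun r => {q | e r q ∈ E}
  let N : (ι → Fin M) → Set (ι → ℕ) := fun r => {q | Minimal (· ∈ F r) q}
  have hN : ∀ r, (N r).Finite := fun r =>
    WellQuasiOrderedLE.finite_of_isAntichain (setOfPred_minimal_antichain _)
  refine ⟨⋃ r, e r '' N r, Set.finite_iUnion fun r => (hN r).image _, ?_, ?_⟩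
  · rintro _ ⟨_, ⟨r, rfl⟩, q, hq, rfl⟩
    exact hq.prop
  · intro a ha
    have h0 := hE a ha
    have hM' : (0 : ℤ) < M := by exact_mod_cast hM
    let r : ι → Fin M := fun i => ⟨(a i % M).toNat, by
      have h1 := Int.emod_nonneg (a i) hM'.ne'
      have h2 := Int.emod_lt_of_pos (a i) hM'
      omega⟩
    let q : ι → ℕ := fun i => (a i / M).toNat
    have hq : e r q = a := by
      funext i
      have h1 := Int.emod_nonneg (a i) hM'.ne'
      have h2 : 0 ≤ a i / M := Int.ediv_nonneg (h0 i) hM'.le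
      simp only [e, r, q, Int.toNat_of_nonneg h1, Int.toNat_of_nonneg h2]
      exact Int.emod_add_mul_ediv (a i) M
    obtain ⟨q', hle, hmin⟩ := exists_minimal_le_of_wellFoundedLT (· ∈ F r) q
      (show e r q ∈ E by rwa [hq])
    refine ⟨e r q', Set.mem_iUnion.2 ⟨r, q', hmin, rfl⟩, fun i => q i - q' i, ?_⟩
    funext i
    rw [← hq]
    have := hle i
    simp only [e, Pi.add_apply]
    push_cast [Nat.cast_sub this]
    ring

/-! ### Consequences of leading exponents: domain, Noetherian, finitely generated -/

namespace LeadingExponents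

variable {K R ι Γ : Type*} [Field K] [Ring R] [Algebra K R] [Fintype ι] [DecidableEq ι]
  [LinearOrder Γ] (D : LeadingExponents K R ι Γ)

/-- The leading exponent of `u` is `a`. -/
def Lead (u : R) (a : ι → ℤ) : Prop :=
  D.coeff u a ≠ 0 ∧ ∀ g, D.ord a < D.ord g → D.coeff u g = 0

/-- The opposite algebra has the same leading exponents. -/
def op : LeadingExponents K Rᵐᵒᵖ ι Γ where
  coeff := D.coeff ∘ₗ (MulOpposite.opLinearEquiv K).symm.toLinearMap
  ord := D.ord
  coeff_injective := D.coeff_injective.comp (MulOpposite.opLinearEquiv K).symm.injective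
  finite_support u := D.finite_support u.unop
  ord_injective := D.ord_injective
  ord_lt := D.ord_lt
  coeff_mul_of_lt u v a b hu hv g hg :=
    D.coeff_mul_of_lt v.unop u.unop b a hv hu g (by rwa [add_comm])
  coeff_mul_add u v a b hu hv := by
    rw [add_comm, mul_comm]
    exact D.coeff_mul_add v.unop u.unop b a hv hu
  nonneg u := D.nonneg u.unop
  period := D.period
  period_pos := D.period_pos
  exists_single i := by
    obtain ⟨u, hu⟩ := D.exists_single i
    exact ⟨MulOpposite.op u, hu⟩

variable {D}

theorem exists_lead {u : R} (hu : u ≠ 0) : ∃ a, D.Lead u a := by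
  have hne : {g | D.coeff u g ≠ 0}.Nonempty := by
    by_contra h
    rw [Set.not_nonempty_iff_eq_empty] at h
    refine hu (D.coeff_injective ?_)
    rw [map_zero]
    funext g
    by_contra hg
    exact (h ▸ hg : g ∈ (∅ : Set (ι → ℤ)))
  obtain ⟨a, ha, hmax⟩ := Set.exists_max_image _ D.ord (D.finite_support u) hne
  refine ⟨a, ha, fun g hg => ?_⟩
  by_contra h
  exact absurd (hmax g h) (not_le.2 hg)

theorem Lead.ne_zero {u : R} {a : ι → ℤ} (h : D.Lead u a) : u ≠ 0 := by
  rintro rfl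
  exact h.1 (by simp)

theorem Lead.nonneg {u : R} {a : ι → ℤ} (h : D.Lead u a) : 0 ≤ a := D.nonneg u a h.1 h.2

theorem Lead.unique {u : R} {a b : ι → ℤ} (ha : D.Lead u a) (hb : D.Lead u b) : a = b := by
  rcases lt_trichotomy (D.ord a) (D.ord b) with h | h | h
  · exact absurd (ha.2 _ h) hb.1
  · exact D.ord_injective h
  · exact absurd (hb.2 _ h) ha.1

theorem Lead.mul {u v : R} {a b : ι → ℤ} (hu : D.Lead u a) (hv : D.Lead v b) :
    D.Lead (u * v) (a + b) := by
  refine ⟨?_, D.coeff_mul_of_lt u v a b hu.2 hv.2⟩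
  rw [D.coeff_mul_add u v a b hu.2 hv.2]
  exact mul_ne_zero hu.1 hv.1

/-- The leading exponent `a` of `1 = 1 * 1` satisfies `a + a = a`. -/
theorem lead_one [Nontrivial R] : D.Lead 1 0 := by
  obtain ⟨a, ha⟩ := D.exists_lead (one_ne_zero (α := R))
  have h := ha.mul ha
  rw [mul_one] at h
  have := h.unique ha
  rw [add_eq_right] at this
  exact this ▸ ha

theorem Lead.sub_smul {u v : R} {a : ι → ℤ} (hu : D.Lead u a) (hv : D.Lead v a) :
    ∃ c : K, u - c • v = 0 ∨ ∃ b, D.Lead (u - c • v) b ∧ D.ord b < D.ord a := by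
  refine ⟨D.coeff u a / D.coeff v a, or_iff_not_imp_left.2 fun h => ?_⟩
  obtain ⟨b, hb⟩ := D.exists_lead h
  refine ⟨b, hb, ?_⟩
  by_contra hab
  rcases (not_lt.1 hab).lt_or_eq with h | h
  · apply hb.1
    simp [hu.2 _ h, hv.2 _ h]
  · have := D.ord_injective h
    subst this
    apply hb.1
    have := hv.1
    simp [this]

theorem noZeroDivisors (D : LeadingExponents K R ι Γ) : NoZeroDivisors R where
  eq_zero_or_eq_zero_of_mul_eq_zero {u v} h := by
    by_contra! hne
    obtain ⟨a, ha⟩ := D.exists_lead hne.1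
    obtain ⟨b, hb⟩ := D.exists_lead hne.2
    exact (ha.mul hb).ne_zero h

theorem finite_nonneg_sum_le (r : ℤ) : {g : ι → ℤ | 0 ≤ g ∧ ∑ i, g i ≤ r}.Finite := by
  refine (Set.finite_Icc (0 : ι → ℤ) (fun _ => r)).subset fun g hg => ⟨hg.1, fun i => ?_⟩
  exact (Finset.single_le_sum (fun j _ => hg.1 j) (Finset.mem_univ i)).trans hg.2

/-- The order need not be well-founded on all of `ℤ^ι`. But a smaller exponent has no larger weight,
and only finitely many nonnegative vectors have bounded weight. -/
theorem induction_on_lead {P : (ι → ℤ) → Prop}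
    (h : ∀ a, 0 ≤ a → (∀ b, 0 ≤ b → D.ord b < D.ord a → P b) → P a) (a : ι → ℤ) (ha : 0 ≤ a) :
    P a := by
  let s : (ι → ℤ) → Set (ι → ℤ) := fun a => {b | 0 ≤ b ∧ D.ord b < D.ord a}
  have hs : ∀ a, (s a).Finite := fun a =>
    (finite_nonneg_sum_le (∑ i, a i)).subset fun b hb => ⟨hb.1, by
      by_contra hlt
      exact absurd (D.ord_lt a b (not_le.1 hlt)) (not_lt.2 hb.2.le)⟩
  induction hc : (s a).ncard using Nat.strong_induction_on generalizing a with
  | _ k ih =>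
    refine h a ha fun b hb hba => ih _ ?_ b hb rfl
    rw [← hc]
    refine Set.ncard_lt_ncard ⟨fun c hc => ⟨hc.1, hc.2.trans hba⟩, fun hsub => ?_⟩ (hs a)
    exact lt_irrefl _ (hsub ⟨hb, hba⟩ : b ∈ s b).2

theorem exists_lead_period_mul [Nontrivial R] (q : ι → ℕ) :
    ∃ u, D.Lead u (fun i => (D.period : ℤ) * q i) := by
  have key : ∀ s : Finset ι,
      ∃ u, D.Lead u (fun i => if i ∈ s then (D.period : ℤ) * q i else 0) := by
    intro s
    induction s using Finset.induction_on with
    | empty => exact ⟨1, by simpa using! D.lead_one⟩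
    | insert j s hj ih =>
      obtain ⟨u, hu⟩ := ih
      obtain ⟨v, hv⟩ := D.exists_single j
      have hpow : ∀ k : ℕ, D.Lead (v ^ k) (Pi.single j ((D.period : ℤ) * k)) := by
        intro k
        induction k with
        | zero => simpa using! D.lead_one
        | succ k ihk =>
          have := ihk.mul (show D.Lead v _ from hv)
          rw [← Pi.single_add, ← pow_succ] at this
          rwa [Nat.cast_succ, mul_add, mul_one]
      refine ⟨u * v ^ q j, ?_⟩
      convert hu.mul (hpow (q j)) using 1
      funext i
      by_cases hij : i = j
      · subst hij; simp [hj]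
      · simp [hij]
  simpa using key Finset.univ

/-- The reduction step of the division algorithm: a left multiple of `v` cancels the leading term of
`u`. -/
theorem exists_sub_smul_mul {u v : R} {a b : ι → ℤ} [Nontrivial R] (hu : D.Lead u a)
    (hv : D.Lead v b) {q : ι → ℕ} (h : a = b + fun i => (D.period : ℤ) * q i) :
    ∃ w : R, D.Lead w (fun i => (D.period : ℤ) * q i) ∧ ∃ c : K, u - c • (w * v) = 0 ∨
      ∃ b, D.Lead (u - c • (w * v)) b ∧ D.ord b < D.ord a := by
  obtain ⟨w, hw⟩ := D.exists_lead_period_mul q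
  refine ⟨w, hw, hu.sub_smul ?_⟩
  rw [h, add_comm]
  exact hw.mul hv

/-- Gröbner basis argument for a left ideal `I`: elements realising the finitely many exponents in
`B` generate `I`, since every element of `I` can be reduced by them to zero. -/
theorem isNoetherianRing [Nontrivial R] (D : LeadingExponents K R ι Γ) : IsNoetherianRing R := by
  refine (isNoetherianRing_iff_ideal_fg R).2 fun I => ?_
  obtain ⟨B, hBf, hBE, hB⟩ := exists_finite_basis_of_period D.period_pos
    {a | ∃ u ∈ I, D.Lead u a} (fun a ⟨u, _, hu⟩ => hu.nonneg)
  have hBE' : ∀ a, a ∈ B → ∃ u ∈ I, D.Lead u a := fun a ha => hBE ha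
  choose! f hfI hf using hBE'
  refine Submodule.fg_def.2 ⟨f '' B, hBf.image f, le_antisymm ?_ ?_⟩
  · rw [Submodule.span_le]
    rintro _ ⟨b, hb, rfl⟩
    exact hfI b hb
  · have key : ∀ a, 0 ≤ a → ∀ u ∈ I, D.Lead u a → u ∈ Submodule.span R (f '' B) := by
      refine induction_on_lead (D := D) fun a ha ih u hu hua => ?_
      obtain ⟨b, hb, q, hq⟩ := hB a ⟨u, hu, hua⟩
      obtain ⟨w, -, c, hc⟩ := exists_sub_smul_mul hua (hf b hb) hq
      have hmem : c • (w * f b) ∈ Submodule.span R (f '' B) := by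
        rw [← smul_mul_assoc]
        exact Submodule.smul_mem _ (c • w) (Submodule.subset_span ⟨b, hb, rfl⟩)
      have hmemI : c • (w * f b) ∈ I := by
        rw [← smul_mul_assoc]
        exact I.mul_mem_left _ (hfI b hb)
      rcases hc with hc | ⟨b', hb', hlt⟩
      · rwa [sub_eq_zero.1 hc]
      · have := ih b' hb'.nonneg hlt _ (I.sub_mem hu hmemI) hb'
        simpa using Submodule.add_mem _ this hmem
    intro u hu
    by_cases h0 : u = 0
    · rw [h0]; exact Submodule.zero_mem _
    · obtain ⟨a, ha⟩ := D.exists_lead h0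
      exact key a ha.nonneg u hu ha

theorem ord_lt_of_lt {a b : ι → ℤ} (h : a < b) : D.ord a < D.ord b := by
  obtain ⟨hle, i, hi⟩ := Pi.lt_def.1 h
  exact D.ord_lt a b (Finset.sum_lt_sum (fun j _ => hle j) ⟨i, Finset.mem_univ i, hi⟩)

/-- The generators realise a finite basis `B` of the nonzero leading exponents. In `a = b + period •
q` the part `period • q` is strictly below `a` because `b ≠ 0`, so the cofactor of the generator
already lies in the subalgebra by induction. -/
theorem finiteType [Nontrivial R] (D : LeadingExponents K R ι Γ) : Algebra.FiniteType K R := by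
  obtain ⟨B, hBf, hBE, hB⟩ := exists_finite_basis_of_period D.period_pos
    {a | a ≠ 0 ∧ ∃ u, D.Lead u a} (fun a ⟨_, u, hu⟩ => hu.nonneg)
  choose hB0 f hf using hBE
  let g : B → R := fun b => f b.2
  have : Finite B := hBf
  refine ⟨⟨(Set.finite_range g).toFinset, ?_⟩⟩
  rw [Set.Finite.coe_toFinset, eq_top_iff]
  have key : ∀ a, 0 ≤ a → ∀ u, D.Lead u a → u ∈ Algebra.adjoin K (Set.range g) := by
    refine induction_on_lead (D := D) fun a ha ih u hua => ?_
    obtain ⟨w, hw, c, hc⟩ : ∃ w ∈ Algebra.adjoin K (Set.range g), ∃ c : K,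
        u - c • w = 0 ∨ ∃ b, D.Lead (u - c • w) b ∧ D.ord b < D.ord a := by
      by_cases h0 : a = 0
      · subst h0
        obtain ⟨c, hc⟩ := hua.sub_smul D.lead_one
        exact ⟨1, one_mem _, c, hc⟩
      · obtain ⟨b, hb, q, hq⟩ := hB a ⟨h0, u, hua⟩
        obtain ⟨w, hw, c, hc⟩ := exists_sub_smul_mul hua (hf hb) hq
        have hb0 : 0 < b := lt_of_le_of_ne (hf hb).nonneg (hB0 hb).symm
        refine ⟨w * f hb, mul_mem ?_ (Algebra.subset_adjoin ⟨⟨b, hb⟩, rfl⟩), c, hc⟩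
        refine ih _ hw.nonneg (ord_lt_of_lt ?_) w hw
        rw [hq]
        exact lt_add_of_pos_left _ hb0
    have hmem := Subalgebra.smul_mem _ hw c
    rcases hc with hc | ⟨b', hb', hlt⟩
    · rwa [sub_eq_zero.1 hc]
    · have := ih b' hb'.nonneg hlt _ hb'
      simpa using add_mem this hmem
  intro u _
  by_cases h0 : u = 0
  · rw [h0]; exact zero_mem _
  · obtain ⟨a, ha⟩ := D.exists_lead h0
    exact key a ha.nonneg u ha

end LeadingExponents

/-! ### Gelfand–Kirillov dimension from leading exponents -/

section GKDim

open Filter Topology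

namespace LeadingExponents

variable {K R ι Γ : Type*} [Field K] [Ring R] [Algebra K R] [Fintype ι] [DecidableEq ι]
  [LinearOrder Γ] (D : LeadingExponents K R ι Γ)

/-- The elements with coefficients of total weight at most `r` only. -/
def weightLE (r : ℕ) : Submodule K R where
  carrier := {u | ∀ g : ι → ℤ, (r : ℤ) < ∑ i, g i → D.coeff u g = 0}
  add_mem' := by
    intro u v hu hv g hg
    simp [hu g hg, hv g hg]
  zero_mem' := by
    intro g _
    simp
  smul_mem' := by
    intro c u hu g hg
    simp [hu g hg]

theorem mem_weightLE_of_lead {u : R} {a : ι → ℤ} (h : D.Lead u a) {r : ℕ}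
    (hr : ∑ i, a i ≤ r) : u ∈ D.weightLE r := fun g hg =>
  h.2 g (D.ord_lt _ _ (lt_of_le_of_lt hr hg))

theorem weightLE_mul (r s : ℕ) : D.weightLE r * D.weightLE s ≤ D.weightLE (r + s) := by
  rw [Submodule.mul_le]
  intro u hu v hv
  by_cases hu0 : u = 0
  · rw [hu0, zero_mul]; exact Submodule.zero_mem _
  by_cases hv0 : v = 0
  · rw [hv0, mul_zero]; exact Submodule.zero_mem _
  obtain ⟨a, ha⟩ := D.exists_lead hu0
  obtain ⟨b, hb⟩ := D.exists_lead hv0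
  refine D.mem_weightLE_of_lead (ha.mul hb) ?_
  have h1 : ∑ i, a i ≤ r := not_lt.1 fun h => ha.1 (hu a h)
  have h2 : ∑ i, b i ≤ s := not_lt.1 fun h => hb.1 (hv b h)
  simp only [Pi.add_apply, Finset.sum_add_distrib]
  push_cast
  omega

theorem one_mem_weightLE [Nontrivial R] : (1 : R) ∈ D.weightLE 0 :=
  D.mem_weightLE_of_lead D.lead_one (by simp)

theorem pow_le_weightLE [Nontrivial R] {V : Submodule K R} {r : ℕ} (hV : V ≤ D.weightLE r)
    (k : ℕ) : V ^ k ≤ D.weightLE (r * k) := by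
  induction k with
  | zero =>
    rw [pow_zero, Submodule.one_eq_span, Submodule.span_le, Set.singleton_subset_iff]
    exact D.one_mem_weightLE
  | succ k ih =>
    rw [pow_succ]
    exact (mul_le_mul' ih hV).trans (D.weightLE_mul _ _)

theorem exists_le_weightLE {V : Submodule K R} (hV : V.FG) : ∃ r, V ≤ D.weightLE r := by
  obtain ⟨s, rfl⟩ := hV
  have h : ∀ u : R, ∃ r, u ∈ D.weightLE r := by
    intro u
    by_cases h0 : u = 0
    · exact ⟨0, h0 ▸ Submodule.zero_mem _⟩
    · obtain ⟨a, ha⟩ := D.exists_lead h0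
      exact ⟨(∑ i, a i).toNat, D.mem_weightLE_of_lead ha (Int.self_le_toNat _)⟩
  choose f hf using h
  refine ⟨s.sup f, Submodule.span_le.2 fun u hu g hg => hf u g (lt_of_le_of_lt ?_ hg)⟩
  exact_mod_cast Finset.le_sup (f := f) hu

/-- A leading exponent is nonnegative of weight at most `r`, hence lies in the box `[0, r]^ι`; an
element with no coefficient there is zero. -/
theorem coeff_box_injective (r : ℕ) : Function.Injective
    ((LinearMap.funLeft K K (fun (q : ι → Fin (r + 1)) (i : ι) => ((q i : ℕ) : ℤ))) ∘ₗ
      D.coeff ∘ₗ (D.weightLE r).subtype) := by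
  rw [injective_iff_map_eq_zero]
  intro u hu
  by_contra h0
  obtain ⟨a, ha⟩ := D.exists_lead (u := (u : R)) (by simpa using h0)
  have hsum : ∑ i, a i ≤ r := not_lt.1 fun h => ha.1 (u.2 a h)
  have hnn := ha.nonneg
  have hle : ∀ i, a i ≤ r := fun i =>
    (Finset.single_le_sum (fun j _ => hnn j) (Finset.mem_univ i)).trans hsum
  have := congrFun hu fun i => ⟨(a i).toNat, by have := hle i; omega⟩
  apply ha.1
  simp only [LinearMap.comp_apply, LinearMap.funLeft_apply, Pi.zero_apply] at this
  rw [show a = fun i => ((a i).toNat : ℤ) from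
    funext fun i => (Int.toNat_of_nonneg (hnn i)).symm]
  exact this

theorem weightLE_finite (r : ℕ) : Module.Finite K (D.weightLE r) :=
  Module.Finite.of_injective _ (D.coeff_box_injective r)

theorem finrank_weightLE_le (r : ℕ) :
    Module.finrank K (D.weightLE r) ≤ (r + 1) ^ Fintype.card ι := by
  refine (LinearMap.finrank_le_finrank_of_injective (D.coeff_box_injective r)).trans ?_
  simp

variable {D}

theorem linearIndependent_of_lead {J : Type*} {f : J → R} {a : J → ι → ℤ}
    (ha : Function.Injective a) (hf : ∀ j, D.Lead (f j) (a j)) : LinearIndependent K f := by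
  classical
  rw [linearIndependent_iff']
  intro s c hc
  by_contra! hne
  obtain ⟨j, hj, hcj⟩ := hne
  obtain ⟨k, hk, hmax⟩ := Finset.exists_max_image (s.filter fun j => c j ≠ 0)
    (fun j => D.ord (a j)) ⟨j, Finset.mem_filter.2 ⟨hj, hcj⟩⟩
  rw [Finset.mem_filter] at hk
  have h := congrFun (congrArg D.coeff hc) (a k)
  rw [map_sum, map_zero, Finset.sum_apply, Finset.sum_eq_single k] at h
  · simp only [map_smul, Pi.smul_apply, smul_eq_mul, Pi.zero_apply, mul_eq_zero] at h
    exact h.elim hk.2 (hf k).1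
  · intro l hl hlk
    by_cases hcl : c l = 0
    · simp [hcl]
    · have hle := hmax l (Finset.mem_filter.2 ⟨hl, hcl⟩)
      have hlt : D.ord (a l) < D.ord (a k) :=
        lt_of_le_of_ne hle fun h => hlk (ha (D.ord_injective h))
      simp [(hf l).2 _ hlt]
  · intro h; exact absurd hk.1 h

/-- There is a finite dimensional subspace containing `1` and leading exponents
`period • eᵢ`. -/
theorem exists_generating_subspace (D : LeadingExponents K R ι Γ) :
    ∃ V : Submodule K R, V.FG ∧ (1 : R) ∈ V ∧
      ∀ i, ∃ u ∈ V, D.Lead u (Pi.single i (D.period : ℤ)) := by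
  choose f hf using D.exists_single
  refine ⟨Submodule.span K (insert 1 (Set.range f)),
    Submodule.fg_span ((Set.finite_range f).insert 1),
    Submodule.subset_span (Set.mem_insert _ _), fun i => ⟨f i, ?_, hf i⟩⟩
  exact Submodule.subset_span (Set.mem_insert_of_mem _ ⟨i, rfl⟩)

/-- One factor with leading exponent `period • eᵢ` is used for each unit of `q`; the remaining
factors are `1`. -/
theorem exists_mem_pow_lead [Nontrivial R] {V : Submodule K R} (h1 : (1 : R) ∈ V)
    (hV : ∀ i, ∃ u ∈ V, D.Lead u (Pi.single i (D.period : ℤ))) (k : ℕ) (q : ι → ℕ)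
    (hq : ∑ i, q i ≤ k) : ∃ u ∈ V ^ k, D.Lead u (fun i => (D.period : ℤ) * q i) := by
  induction k generalizing q with
  | zero =>
    have : q = 0 := by
      funext i
      have := Finset.single_le_sum (fun j _ => Nat.zero_le (q j)) (Finset.mem_univ i)
      simp only [Pi.zero_apply]
      omega
    subst this
    refine ⟨1, by rw [pow_zero]; exact Submodule.one_le.1 le_rfl, ?_⟩
    simpa using! D.lead_one
  | succ k ih =>
    by_cases hq0 : ∃ i, q i ≠ 0
    · obtain ⟨i, hi⟩ := hq0
      have hsplit : q = Function.update q i (q i - 1) + Pi.single i 1 := by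
        funext j
        by_cases hj : j = i
        · subst hj; simp; omega
        · simp [hj]
      have hs : ∑ j, q j = ∑ j, Function.update q i (q i - 1) j + 1 := by
        conv_lhs => rw [hsplit]
        simp [Finset.sum_add_distrib]
      obtain ⟨u, hu, hul⟩ := ih (Function.update q i (q i - 1)) (by omega)
      obtain ⟨v, hv, hvl⟩ := hV i
      refine ⟨u * v, by rw [pow_succ]; exact Submodule.mul_mem_mul hu hv, ?_⟩
      convert hul.mul hvl using 1
      funext j
      conv_lhs => rw [hsplit]
      by_cases hj : j = i
      · subst hj; simp; ring
      · simp [hj]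
    · push Not at hq0
      obtain ⟨u, hu, hul⟩ := ih q (by simp [hq0])
      exact ⟨u * 1, by rw [pow_succ]; exact Submodule.mul_mem_mul hu h1, by rwa [mul_one]⟩

/-- The box `0 ≤ q i ≤ k / card ι` lies in the simplex `∑ q i ≤ k`, and elements with distinct
leading exponents are linearly independent. -/
theorem pow_card_le_finrank [Nontrivial R] {V : Submodule K R} (h1 : (1 : R) ∈ V)
    (hfg : V.FG) (hV : ∀ i, ∃ u ∈ V, D.Lead u (Pi.single i (D.period : ℤ))) (k : ℕ) :
    (k / Fintype.card ι + 1) ^ Fintype.card ι ≤ Module.finrank K ↥(V ^ k) := by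
  have hq : ∀ q : ι → Fin (k / Fintype.card ι + 1), ∃ u ∈ V ^ k,
      D.Lead u (fun i => (D.period : ℤ) * (q i : ℕ)) := by
    intro q
    refine exists_mem_pow_lead h1 hV k (fun i => (q i : ℕ)) ?_
    calc ∑ i, (q i : ℕ) ≤ ∑ _i : ι, k / Fintype.card ι :=
          Finset.sum_le_sum fun i _ => Nat.lt_succ_iff.1 (q i).2
      _ ≤ k := by
          rw [Finset.sum_const, Finset.card_univ, smul_eq_mul]
          exact Nat.mul_div_le _ _
  choose f hfV hf using hq
  have hli : LinearIndependent K f := by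
    refine linearIndependent_of_lead (fun q q' h => ?_) hf
    funext i
    have := congrFun h i
    have hp : (D.period : ℤ) ≠ 0 := by exact_mod_cast D.period_pos.ne'
    have := mul_left_cancel₀ hp this
    exact Fin.ext (by exact_mod_cast this)
  have hli' : LinearIndependent K (fun q => (⟨f q, hfV q⟩ : ↥(V ^ k))) :=
    LinearIndependent.of_comp (V ^ k).subtype hli
  have : Module.Finite K ↥(V ^ k) := Module.Finite.iff_fg.2 (hfg.pow k)
  simpa using hli'.fintype_card_le_finrank

theorem tendsto_add_mul_log_div_log (c : ℝ) (N : ℕ) : Tendsto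
    (fun k : ℕ => (((N * (c + Real.log k)) / Real.log k : ℝ) : EReal)) atTop (𝓝 (N : EReal)) := by
  have hlog : Tendsto (fun k : ℕ => Real.log k) atTop atTop :=
    Real.tendsto_log_atTop.comp tendsto_natCast_atTop_atTop
  have h : Tendsto (fun k : ℕ => (N * (c / Real.log k + 1) : ℝ)) atTop (𝓝 (N : ℝ)) := by
    simpa using ((hlog.const_div_atTop c).add_const 1).const_mul (N : ℝ)
  have h2 : Tendsto (fun k : ℕ => ((N * (c / Real.log k + 1) : ℝ) : EReal)) atTop
      (𝓝 ((N : ℝ) : EReal)) := (continuous_coe_real_ereal.tendsto _).comp h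
  refine h2.congr' ?_
  filter_upwards [hlog.eventually_gt_atTop 0] with k hk
  congr 1
  field_simp

theorem gkDim_le [Nontrivial R] (D : LeadingExponents K R ι Γ) :
    gkDim K R ≤ (Fintype.card ι : EReal) := by
  refine iSup_le fun V => ?_
  obtain ⟨r, hr⟩ := D.exists_le_weightLE V.2.1
  set N := Fintype.card ι
  rw [← (tendsto_add_mul_log_div_log (Real.log (r + 1)) N).limsup_eq]
  refine limsup_le_limsup ?_
  filter_upwards [eventually_ge_atTop 1] with k hk
  have hk' : (1 : ℝ) ≤ k := by exact_mod_cast hk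
  rw [EReal.coe_le_coe_iff]
  refine div_le_div_of_nonneg_right ?_ (Real.log_nonneg hk')
  have hfin := D.weightLE_finite (r * k)
  -- `V ^ k` has weight at most `r k`, and `r k + 1 ≤ (r + 1) k` since `k ≥ 1`.
  have h1 : Module.finrank K ↥(V.1 ^ k) ≤ ((r + 1) * k) ^ N := by
    refine ((Submodule.finrank_mono (D.pow_le_weightLE hr k)).trans
      (D.finrank_weightLE_le _)).trans (Nat.pow_le_pow_left ?_ _)
    nlinarith
  have h2 : Real.log (((r + 1) * k : ℝ) ^ N) = N * (Real.log (r + 1) + Real.log k) := by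
    rw [Real.log_pow, Real.log_mul (by positivity) (by positivity)]
  rw [← h2]
  rcases Nat.eq_zero_or_pos (Module.finrank K ↥(V.1 ^ k)) with h0 | h0
  · rw [h0, Nat.cast_zero, Real.log_zero]
    refine Real.log_nonneg (one_le_pow₀ ?_)
    nlinarith [(Nat.cast_nonneg r : (0 : ℝ) ≤ r)]
  · refine Real.log_le_log (by exact_mod_cast h0) ?_
    exact_mod_cast h1

theorem le_gkDim [Nontrivial R] (D : LeadingExponents K R ι Γ) :
    (Fintype.card ι : EReal) ≤ gkDim K R := by
  obtain ⟨V, hfg, h1, hV⟩ := D.exists_generating_subspace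
  refine le_trans ?_ (le_iSup _ (⟨V, hfg, h1⟩ : {V : Submodule K R // V.FG ∧ (1 : R) ∈ V}))
  set N := Fintype.card ι with hN
  rw [← (tendsto_add_mul_log_div_log (-Real.log N) N).limsup_eq]
  refine limsup_le_limsup ?_
  filter_upwards [eventually_ge_atTop 1] with k hk
  have hk' : (1 : ℝ) ≤ k := by exact_mod_cast hk
  rw [EReal.coe_le_coe_iff]
  refine div_le_div_of_nonneg_right ?_ (Real.log_nonneg hk')
  rcases Nat.eq_zero_or_pos N with h0 | h0
  · rw [h0, Nat.cast_zero, zero_mul]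
    exact Real.log_natCast_nonneg _
  have h0' : (0 : ℝ) < N := by exact_mod_cast h0
  have h2 : Real.log ((k / N : ℝ) ^ N) = N * (-Real.log N + Real.log k) := by
    rw [Real.log_pow, Real.log_div (by positivity) (by positivity)]
    ring
  rw [← h2]
  refine Real.log_le_log (by positivity) ?_
  have h3 : (((k / N + 1) ^ N : ℕ) : ℝ) ≤ Module.finrank K ↥(V ^ k) := by
    exact_mod_cast pow_card_le_finrank h1 hfg hV k
  refine le_trans ?_ h3
  push_cast
  refine pow_le_pow_left₀ (by positivity) ?_ _
  exact Nat.lt_floor_add_one (k / N : ℝ) |>.le.trans_eq (by rw [Nat.floor_div_eq_div])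

theorem gkDim_eq [Nontrivial R] (D : LeadingExponents K R ι Γ) :
    gkDim K R = (Fintype.card ι : EReal) :=
  le_antisymm D.gkDim_le D.le_gkDim

end LeadingExponents

end GKDim

section MultiCusp

open MvPolynomial

/-! ### Shifts, finite differences and summation of polynomials -/

section Polynomials

variable {σ K : Type*} [Field K]

/-- The substitution `Xᵢ ↦ Xᵢ + sᵢ`. -/
noncomputable def polyShift (s : σ → K) : MvPolynomial σ K →ₐ[K] MvPolynomial σ K :=
  aeval fun i => X i + C (s i)

theorem eval_polyShift (s x : σ → K) (f : MvPolynomial σ K) :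
    eval x (polyShift s f) = eval (fun i => x i + s i) f := by
  have : (aeval x).comp (polyShift s) = aeval (R := K) fun i => x i + s i := by
    refine MvPolynomial.algHom_ext fun i => ?_
    simp [polyShift]
  simpa [aeval_eq_eval] using congrArg (fun φ => φ f) this

/-- Having leading monomial `d` with all other exponents componentwise below `d` is a multiplicative
property. It reduces the shift of a monomial to the shift of a variable. -/
theorem coeff_mul_sub_monomial_lt {g g' : MvPolynomial σ K} {d d' : σ →₀ ℕ}
    (h : ∀ e, coeff e (g - monomial d 1) ≠ 0 → e < d)
    (h' : ∀ e, coeff e (g' - monomial d' 1) ≠ 0 → e < d') (e : σ →₀ ℕ)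
    (he : coeff e (g * g' - monomial (d + d') 1) ≠ 0) : e < d + d' := by
  classical
  have hg : ∀ e, coeff e g ≠ 0 → e ≤ d := by
    intro e hce
    by_cases hed : d = e
    · exact hed.ge
    · refine (h e ?_).le
      rwa [coeff_sub, coeff_monomial, if_neg hed, sub_zero]
  have hsplit : g * g' - monomial (d + d') 1 =
      g * (g' - monomial d' 1) + (g - monomial d 1) * monomial d' 1 := by
    have : (monomial (d + d') 1 : MvPolynomial σ K) = monomial d 1 * monomial d' 1 := by
      rw [monomial_mul, one_mul]
    rw [this]; ring
  rw [hsplit, coeff_add] at he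
  rcases ne_or_eq (coeff e (g * (g' - monomial d' 1))) 0 with h1 | h1
  · rw [coeff_mul] at h1
    obtain ⟨⟨a, b⟩, hab, hne⟩ := Finset.exists_ne_zero_of_sum_ne_zero h1
    rw [Finset.HasAntidiagonal.mem_antidiagonal] at hab
    rw [← hab]
    exact add_lt_add_of_le_of_lt (hg a (left_ne_zero_of_mul hne)) (h' b (right_ne_zero_of_mul hne))
  · rw [h1, zero_add, coeff_mul] at he
    obtain ⟨⟨a, b⟩, hab, hne⟩ := Finset.exists_ne_zero_of_sum_ne_zero he
    rw [Finset.HasAntidiagonal.mem_antidiagonal] at hab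
    rw [← hab]
    have hb : d' = b := by
      by_contra hb
      exact right_ne_zero_of_mul hne (by simp only; rw [coeff_monomial, if_neg hb])
    rw [← hb]
    exact add_lt_add_left (h a (left_ne_zero_of_mul hne)) d'

theorem coeff_polyShift_monomial_lt (s : σ → K) (d e : σ →₀ ℕ)
    (he : coeff e (polyShift s (monomial d 1) - monomial d 1) ≠ 0) : e < d := by
  classical
  have hzero : ∀ e : σ →₀ ℕ, coeff e (polyShift s (monomial 0 1) - monomial 0 1) ≠ 0 → e < 0 := by
    intro e he
    rw [← one_def, map_one, sub_self, coeff_zero] at he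
    exact absurd rfl he
  have hadd : ∀ d d' : σ →₀ ℕ,
      (∀ e, coeff e (polyShift s (monomial d 1) - monomial d 1) ≠ 0 → e < d) →
      (∀ e, coeff e (polyShift s (monomial d' 1) - monomial d' 1) ≠ 0 → e < d') →
      ∀ e, coeff e (polyShift s (monomial (d + d') 1) - monomial (d + d') 1) ≠ 0 → e < d + d' := by
    intro d d' h h' e he
    refine coeff_mul_sub_monomial_lt h h' e ?_
    rwa [← map_mul, monomial_mul, one_mul]
  have hone : ∀ (i : σ) (e : σ →₀ ℕ), coeff e (polyShift s (monomial (Finsupp.single i 1) 1) -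
      monomial (Finsupp.single i 1) 1) ≠ 0 → e < Finsupp.single i 1 := by
    intro i e he
    change coeff e (polyShift s (X i) - X i) ≠ 0 at he
    rw [polyShift, aeval_X, add_sub_cancel_left, coeff_C] at he
    have he0 : 0 = e := by
      by_contra h
      exact he (if_neg h)
    rw [← he0]
    exact pos_of_ne_zero (by simp)
  induction d using Finsupp.induction_linear generalizing e with
  | zero => exact hzero e he
  | add d d' h h' => exact hadd d d' h h' e he
  | single i k =>
    induction k generalizing e with
    | zero =>
      rw [Finsupp.single_zero] at he ⊢
      exact hzero e he
    | succ k ih =>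
      rw [Finsupp.single_add] at he ⊢
      exact hadd _ _ ih (hone i) e he

theorem exists_lt_of_coeff_polyShift_sub_ne_zero (s : σ → K) (f : MvPolynomial σ K) (e : σ →₀ ℕ)
    (he : coeff e (polyShift s f - f) ≠ 0) : ∃ d, coeff d f ≠ 0 ∧ e < d := by
  have hf : polyShift s f - f =
      ∑ d ∈ f.support, coeff d f • (polyShift s (monomial d 1) - monomial d 1) := by
    conv_lhs => rw [f.as_sum]
    rw [map_sum, ← Finset.sum_sub_distrib]
    refine Finset.sum_congr rfl fun d _ => ?_
    have : monomial d (coeff d f) = coeff d f • (monomial d 1 : MvPolynomial σ K) := by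
      rw [smul_monomial, smul_eq_mul, mul_one]
    rw [this, map_smul, smul_sub]
  rw [hf, coeff_sum] at he
  obtain ⟨d, hd, hne⟩ := Finset.exists_ne_zero_of_sum_ne_zero he
  rw [coeff_smul] at hne
  exact ⟨d, mem_support_iff.1 hd, coeff_polyShift_monomial_lt s d e (right_ne_zero_of_mul hne)⟩

theorem exists_le_of_coeff_polyShift_ne_zero (s : σ → K) (f : MvPolynomial σ K) (e : σ →₀ ℕ)
    (he : coeff e (polyShift s f) ≠ 0) : ∃ d, coeff d f ≠ 0 ∧ e ≤ d := by
  by_cases h : coeff e f = 0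
  · obtain ⟨d, hd, hlt⟩ := exists_lt_of_coeff_polyShift_sub_ne_zero s f e
      (by rwa [coeff_sub, h, sub_zero])
    exact ⟨d, hd, hlt.le⟩
  · exact ⟨e, h, le_rfl⟩

/-- Each exponent of the difference lies strictly below an exponent of `f`. This is what makes
commutators lower the order of an operator. -/
theorem totalDegree_polyShift_sub_lt (s : σ → K) (f : MvPolynomial σ K) :
    polyShift s f - f = 0 ∨ (polyShift s f - f).totalDegree < f.totalDegree := by
  refine or_iff_not_imp_left.2 fun h => ?_
  have hlt : ∀ e ∈ (polyShift s f - f).support, e.degree < f.totalDegree := by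
    intro e he
    obtain ⟨d, hd, hed⟩ := exists_lt_of_coeff_polyShift_sub_ne_zero s f e (mem_support_iff.1 he)
    refine lt_of_lt_of_le ?_ (le_totalDegree (mem_support_iff.2 hd))
    have : d = e + (d - e) := (add_tsub_cancel_of_le hed.le).symm
    change e.degree < d.degree
    rw [this, map_add]
    refine lt_add_of_pos_right _ (Nat.pos_of_ne_zero fun h0 => ?_)
    rw [Finsupp.degree_eq_zero_iff] at h0
    rw [h0, add_zero] at this
    exact hed.ne this.symm
  obtain ⟨e, he⟩ := support_nonempty.2 h
  exact (Finset.sup_lt_iff (lt_of_le_of_lt bot_le (hlt e he))).2 hlt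

theorem eq_zero_of_forall_eval_natCast_eq_zero [CharZero K] (N : ℕ) (f : MvPolynomial σ K)
    (h : ∀ γ : σ → ℕ, (∀ i, N ≤ γ i) → eval (fun i => (γ i : K)) f = 0) : f = 0 := by
  refine funext_set (fun _ => (Nat.cast : ℕ → K) '' Set.Ici N)
    (fun _ => (Set.Ici_infinite N).image Nat.cast_injective.injOn) fun x hx => ?_
  choose γ hγ hx using fun i => hx i (Set.mem_univ i)
  obtain rfl : (fun i => (γ i : K)) = x := funext hx
  rw [h γ hγ, map_zero]

variable [CharZero K] [Fintype σ]

/-- Faulhaber's formula with Bernoulli polynomials over `ℚ`, transported to `K` by characteristic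
zero. -/
theorem exists_polynomial_eval_eq_sum_range_pow (d : ℕ) :
    ∃ F : Polynomial K, ∀ N : ℕ, F.eval (N : K) = ∑ t ∈ Finset.range N, (t : K) ^ d := by
  let G : Polynomial ℚ := Polynomial.C (1 / (d + 1 : ℚ)) *
    (Polynomial.bernoulli (d + 1) - Polynomial.C (bernoulli (d + 1)))
  refine ⟨G.map (algebraMap ℚ K), fun N => ?_⟩
  have h : G.eval (N : ℚ) = ∑ t ∈ Finset.range N, (t : ℚ) ^ d := by
    have := Polynomial.sum_range_pow_eq_bernoulli_sub N d
    simp only [G, Polynomial.eval_mul, Polynomial.eval_C, Polynomial.eval_sub]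
    rw [← Nat.succ_eq_add_one, ← this]
    have : (d + 1 : ℚ) ≠ 0 := by positivity
    field_simp
  have h2 := congrArg (algebraMap ℚ K) h
  rw [← map_natCast (algebraMap ℚ K) N, Polynomial.eval_map_algebraMap,
    Polynomial.aeval_algebraMap_apply, Polynomial.coe_aeval_eq_eval, h2]
  simp

theorem exists_eval_eq_sum_range [DecidableEq σ] (i : σ) (p : MvPolynomial σ K) :
    ∃ P : MvPolynomial σ K, ∀ γ : σ → ℕ, eval (fun j => (γ j : K)) P =
      ∑ t ∈ Finset.range (γ i), eval (fun j => (Function.update γ i t j : K)) p := by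
  induction p using MvPolynomial.induction_on' with
  | add p q hp hq =>
    obtain ⟨P, hP⟩ := hp
    obtain ⟨Q, hQ⟩ := hq
    exact ⟨P + Q, fun γ => by simp [hP, hQ, Finset.sum_add_distrib]⟩
  | monomial d c =>
    obtain ⟨F, hF⟩ := exists_polynomial_eval_eq_sum_range_pow (K := K) (d i)
    refine ⟨(C c * ∏ j ∈ Finset.univ.erase i, X j ^ d j) * Polynomial.aeval (X i) F, fun γ => ?_⟩
    have h1 : eval (fun j => (γ j : K)) (Polynomial.aeval (X i) F) = F.eval (γ i : K) := by
      rw [← Polynomial.coe_aeval_eq_eval, ← aeval_eq_eval, ← Polynomial.aeval_algHom_apply]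
      simp
    rw [map_mul, h1, hF, Finset.mul_sum]
    refine Finset.sum_congr rfl fun t _ => ?_
    rw [eval_monomial, Finsupp.prod_fintype _ _ (by simp),
      ← Finset.mul_prod_erase _ _ (Finset.mem_univ i), map_mul, eval_C, map_prod]
    have : ∀ j ∈ Finset.univ.erase i, eval (fun j => (γ j : K)) (X j ^ d j) =
        (Function.update γ i t j : K) ^ d j := by
      intro j hj
      rw [Function.update_of_ne (Finset.ne_of_mem_erase hj)]
      simp
    rw [Finset.prod_congr rfl this, Function.update_self]
    ring

/-- A function on `ℕ^σ` is polynomial if its differences in all directions are. -/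
theorem exists_eval_eq_of_differences [DecidableEq σ] (g : (σ → ℕ) → K)
    (h : ∀ i, ∃ p : MvPolynomial σ K, ∀ γ : σ → ℕ,
      g (γ + Pi.single i 1) - g γ = eval (fun j => (γ j : K)) p) :
    ∃ P : MvPolynomial σ K, ∀ γ : σ → ℕ, g γ = eval (fun j => (γ j : K)) P := by
  -- Induction on the set `s` of coordinates allowed to be nonzero. Freeing the coordinate `i` adds
  -- the telescoping sum of the differences in that direction.
  suffices key : ∀ s : Finset σ, ∃ P : MvPolynomial σ K, ∀ γ : σ → ℕ,
      (∀ i ∉ s, γ i = 0) → g γ = eval (fun j => (γ j : K)) P by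
    obtain ⟨P, hP⟩ := key Finset.univ
    exact ⟨P, fun γ => hP γ (by simp)⟩
  intro s
  induction s using Finset.induction_on with
  | empty =>
    refine ⟨C (g 0), fun γ hγ => ?_⟩
    obtain rfl : γ = 0 := funext fun i => hγ i (by simp)
    simp
  | insert i s hi ih =>
    obtain ⟨P, hP⟩ := ih
    obtain ⟨p, hp⟩ := h i
    obtain ⟨Q, hQ⟩ := exists_eval_eq_sum_range i p
    refine ⟨aeval (Function.update X i 0) P + Q, fun γ hγ => ?_⟩
    have h1 : g γ = g (Function.update γ i 0) +
        ∑ t ∈ Finset.range (γ i), eval (fun j => (Function.update γ i t j : K)) p := by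
      have : ∀ t, g (Function.update γ i (t + 1)) - g (Function.update γ i t) =
          eval (fun j => (Function.update γ i t j : K)) p := by
        intro t
        rw [← hp]
        congr 2
        funext j
        by_cases hj : j = i
        · subst hj; simp
        · simp [hj]
      rw [Finset.sum_congr rfl fun t _ => (this t).symm,
        Finset.sum_range_sub (fun t => g (Function.update γ i t)), Function.update_eq_self]
      ring
    rw [h1, map_add, hQ, hP]
    · congr 1
      rw [← aeval_eq_eval, ← aeval_eq_eval]
      change _ = ((aeval fun j => (γ j : K)).comp (aeval (Function.update X i 0))) P
      congr 1
      refine MvPolynomial.algHom_ext fun j => ?_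
      by_cases hj : j = i
      · subst hj; simp
      · simp [hj]
    · intro j hj
      by_cases hji : j = i
      · subst hji; simp
      · rw [Function.update_of_ne hji]
        exact hγ j (by simp [hji, hj])

end Polynomials

/-! ### Exponent vectors and evaluation at integer points -/

section Exponents

variable {n : ℕ}

/-- The exponents of the monomials of the generalized multi-cusp algebra, as integer vectors. -/
def cuspExponents (m : Fin n → ℕ) : AddSubmonoid (Fin n → ℤ) where
  carrier := {γ | ∀ i, γ i = 0 ∨ (0 < γ i ∧ (m i : ℤ) ≤ γ i)}
  zero_mem' := fun _ => Or.inl rfl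
  add_mem' := by
    intro a b ha hb i
    have := ha i
    have := hb i
    simp only [Pi.add_apply]
    omega

theorem nonneg_of_mem_cuspExponents {m : Fin n → ℕ} {γ : Fin n → ℤ} (h : γ ∈ cuspExponents m) :
    0 ≤ γ := fun i => by
  have := h i
  simp only [Pi.zero_apply]
  omega

/-- The natural exponent vector with the entries of a nonnegative integer vector. -/
noncomputable def natExp (γ : Fin n → ℤ) : Fin n →₀ ℕ :=
  Finsupp.equivFunOnFinite.symm fun i => (γ i).toNat

/-- A natural exponent vector as an integer vector. -/
def intExp (b : Fin n →₀ ℕ) : Fin n → ℤ := fun i => b i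

@[simp] theorem natExp_apply (γ : Fin n → ℤ) (i : Fin n) : natExp γ i = (γ i).toNat := rfl

@[simp] theorem intExp_apply (b : Fin n →₀ ℕ) (i : Fin n) : intExp b i = b i := rfl

@[simp] theorem natExp_intExp (b : Fin n →₀ ℕ) : natExp (intExp b) = b := by
  ext i; simp

theorem intExp_natExp {γ : Fin n → ℤ} (h : 0 ≤ γ) : intExp (natExp γ) = γ := by
  funext i
  exact Int.toNat_of_nonneg (h i)

theorem intExp_nonneg (b : Fin n →₀ ℕ) : 0 ≤ intExp b := fun i => Int.natCast_nonneg (b i)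

theorem intExp_injective : Function.Injective (intExp (n := n)) :=
  Function.LeftInverse.injective natExp_intExp

theorem natExp_add {γ δ : Fin n → ℤ} (hγ : 0 ≤ γ) (hδ : 0 ≤ δ) :
    natExp (γ + δ) = natExp γ + natExp δ := by
  ext i
  exact Int.toNat_add (hγ i) (hδ i)

theorem intExp_add (b c : Fin n →₀ ℕ) : intExp (b + c) = intExp b + intExp c := by
  funext i; simp

variable {K : Type*} [Field K]

open Classical in
/-- The coefficient of `x^γ` for an integer vector `γ`. -/
noncomputable def intCoeff (γ : Fin n → ℤ) : MvPolynomial (Fin n) K →ₗ[K] K :=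
  if 0 ≤ γ then lcoeff K (natExp γ) else 0

theorem intCoeff_of_nonneg {γ : Fin n → ℤ} (h : 0 ≤ γ) (p : MvPolynomial (Fin n) K) :
    intCoeff γ p = coeff (natExp γ) p := by
  rw [intCoeff, if_pos h, lcoeff_apply]

theorem intCoeff_of_not_nonneg {γ : Fin n → ℤ} (h : ¬ 0 ≤ γ) (p : MvPolynomial (Fin n) K) :
    intCoeff γ p = 0 := by
  rw [intCoeff, if_neg h, LinearMap.zero_apply]

@[simp] theorem intCoeff_intExp (b : Fin n →₀ ℕ) (p : MvPolynomial (Fin n) K) :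
    intCoeff (intExp b) p = coeff b p := by
  rw [intCoeff_of_nonneg (intExp_nonneg b), natExp_intExp]

theorem nonneg_of_intCoeff_ne_zero {γ : Fin n → ℤ} {p : MvPolynomial (Fin n) K}
    (h : intCoeff γ p ≠ 0) : 0 ≤ γ := by
  by_contra h'
  exact h (intCoeff_of_not_nonneg h' p)

theorem finite_intCoeff_ne_zero (p : MvPolynomial (Fin n) K) :
    {γ | intCoeff γ p ≠ 0}.Finite := by
  refine (p.support.finite_toSet.image intExp).subset fun γ hγ => ?_
  have h := nonneg_of_intCoeff_ne_zero hγ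
  refine ⟨natExp γ, ?_, intExp_natExp h⟩
  rw [Set.mem_ofPred_eq, intCoeff_of_nonneg h] at hγ
  exact mem_support_iff.2 hγ

theorem intCoeff_monomial [DecidableEq (Fin n → ℤ)] {γ δ : Fin n → ℤ} (h : 0 ≤ δ) (c : K) :
    intCoeff γ (monomial (natExp δ) c) = if γ = δ then c else 0 := by
  classical
  by_cases hγ : 0 ≤ γ
  · rw [intCoeff_of_nonneg hγ, coeff_monomial]
    have : natExp δ = natExp γ ↔ γ = δ := by
      constructor
      · intro he
        rw [← intExp_natExp h, he, intExp_natExp hγ]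
      · rintro rfl; rfl
    simp only [this]
  · rw [intCoeff_of_not_nonneg hγ, if_neg]
    rintro rfl
    exact hγ h

theorem intCoeff_monomial_mul {s : Fin n → ℤ} (hs : 0 ≤ s) (γ : Fin n → ℤ)
    (p : MvPolynomial (Fin n) K) :
    intCoeff (γ + s) (monomial (natExp s) 1 * p) = intCoeff γ p := by
  by_cases hγ : 0 ≤ γ
  · rw [intCoeff_of_nonneg hγ, intCoeff_of_nonneg (add_nonneg hγ hs), natExp_add hγ hs, add_comm,
      coeff_monomial_mul, one_mul]
  · rw [intCoeff_of_not_nonneg hγ]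
    by_cases hγs : 0 ≤ γ + s
    · rw [intCoeff_of_nonneg hγs, coeff_monomial_mul', if_neg]
      intro hle
      refine hγ fun i => ?_
      have h1 := hle i
      have h2 := hs i
      have h3 := hγs i
      simp only [natExp_apply, Pi.add_apply, Pi.zero_apply] at h1 h2 h3 ⊢
      omega
    · rw [intCoeff_of_not_nonneg hγs]

/-- Evaluation at an integer vector. -/
noncomputable def evalInt (γ : Fin n → ℤ) : MvPolynomial (Fin n) K →+* K :=
  eval fun i => (γ i : K)

theorem evalInt_polyShift (s γ : Fin n → ℤ) (f : MvPolynomial (Fin n) K) :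
    evalInt γ (polyShift (fun i => (s i : K)) f) = evalInt (γ + s) f := by
  rw [evalInt, eval_polyShift, evalInt]
  simp

@[simp] theorem evalInt_C (γ : Fin n → ℤ) (c : K) : evalInt γ (C c) = c := eval_C c

@[simp] theorem evalInt_X (γ : Fin n → ℤ) (i : Fin n) : evalInt γ (X i : MvPolynomial _ K) = γ i :=
  eval_X i

/-- A polynomial vanishing at all exponents is zero. -/
theorem eq_zero_of_evalInt_eq_zero [CharZero K] (N : ℕ) {f : MvPolynomial (Fin n) K}
    (h : ∀ γ : Fin n → ℤ, (∀ i, (N : ℤ) ≤ γ i) → evalInt γ f = 0) : f = 0 := by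
  refine eq_zero_of_forall_eval_natCast_eq_zero N f fun γ hγ => ?_
  simpa [evalInt] using h (fun i => γ i) fun i => by exact_mod_cast hγ i

/-- A bound for all the `m i`. -/
def cuspBound (m : Fin n → ℕ) : ℕ := ∑ i, m i + 1

theorem le_cuspBound (m : Fin n → ℕ) (i : Fin n) : m i ≤ cuspBound m :=
  (Finset.single_le_sum (f := m) (fun _ _ => Nat.zero_le _) (Finset.mem_univ i)).trans
    (Nat.le_succ _)

theorem cuspBound_pos (m : Fin n → ℕ) : 0 < cuspBound m := Nat.succ_pos _

theorem mem_cuspExponents_of_le {m : Fin n → ℕ} {γ : Fin n → ℤ}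
    (h : ∀ i, γ i = 0 ∨ (cuspBound m : ℤ) ≤ γ i) : γ ∈ cuspExponents m := fun i => by
  have h1 := h i
  have h2 := le_cuspBound m i
  have h3 := cuspBound_pos m
  omega

/-- The exponents contain all integer vectors beyond the bound, which form a Zariski dense set.
Hence symbols are unique. -/
theorem eq_of_evalInt_eq [CharZero K] {m : Fin n → ℕ} {f g : MvPolynomial (Fin n) K}
    (h : ∀ γ ∈ cuspExponents m, evalInt γ f = evalInt γ g) : f = g := by
  rw [← sub_eq_zero]
  refine eq_zero_of_evalInt_eq_zero (cuspBound m) fun γ hγ => ?_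
  rw [map_sub, sub_eq_zero]
  exact h γ (mem_cuspExponents_of_le fun i => Or.inr (hγ i))

end Exponents

/-! ### Monomial description of the multi-cusp algebra -/

section MultiCusp

variable {K : Type*} [Field K] {n : ℕ} {m : Fin n → ℕ}

theorem mem_multiCuspAlgebra {p : MvPolynomial (Fin n) K} :
    p ∈ multiCuspAlgebra K m ↔ ∀ b, coeff b p ≠ 0 → intExp b ∈ cuspExponents m := by
  classical
  constructor
  -- The exponents form a monoid, so the polynomials supported on them form a subalgebra `B`; it
  -- suffices that `B` contains each copy of a cusp algebra.
  · let B : Subalgebra K (MvPolynomial (Fin n) K) :=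
      { carrier := {p | ∀ b, coeff b p ≠ 0 → intExp b ∈ cuspExponents m}
        mul_mem' := by
          intro p q hp hq b hb
          rw [coeff_mul] at hb
          obtain ⟨⟨c, d⟩, hcd, hne⟩ := Finset.exists_ne_zero_of_sum_ne_zero hb
          rw [Finset.HasAntidiagonal.mem_antidiagonal] at hcd
          rw [← hcd, intExp_add]
          exact add_mem (hp c (left_ne_zero_of_mul hne)) (hq d (right_ne_zero_of_mul hne))
        add_mem' := by
          intro p q hp hq b hb
          rw [coeff_add] at hb
          by_cases h : coeff b p = 0
          · exact hq b (by rwa [h, zero_add] at hb)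
          · exact hp b h
        algebraMap_mem' := by
          intro c b hb
          rw [algebraMap_eq, coeff_C] at hb
          have : 0 = b := by
            by_contra h
            exact hb (if_neg h)
          rw [← this]
          exact fun i => Or.inl rfl }
    suffices h : multiCuspAlgebra K m ≤ B from fun hp => h hp
    refine iSup_le fun i => ?_
    rintro _ ⟨q, hq, rfl⟩
    change Polynomial.aeval (X i) q ∈ B
    rw [Polynomial.aeval_eq_sum_range]
    refine sum_mem fun j _ => ?_
    by_cases hj : q.coeff j = 0
    · rw [hj, zero_smul]; exact zero_mem _
    refine Subalgebra.smul_mem _ ?_ _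
    intro b hb
    rw [coeff_X_pow] at hb
    have hbj : Finsupp.single i j = b := by
      by_contra h
      exact hb (if_neg h)
    intro k
    rw [← hbj]
    by_cases hk : k = i
    · subst hk
      simp only [intExp_apply, Finsupp.single_eq_same]
      by_contra! hcon
      have h0 : 0 < j := Nat.pos_of_ne_zero fun h => hcon.1 (by simp [h])
      exact hj (hq j h0 (by have := hcon.2 (by exact_mod_cast h0); omega))
    · left
      simp [Ne.symm hk]
  · intro h
    rw [p.as_sum]
    refine sum_mem fun b hb => ?_
    have hb := h b (mem_support_iff.1 hb)
    rw [monomial_eq, ← algebraMap_eq, ← Algebra.smul_def]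
    refine Subalgebra.smul_mem _ ?_ _
    refine prod_mem fun i _ => ?_
    refine (le_iSup (fun i : Fin n => (cuspAlgebra K (m i)).map (Polynomial.aeval (X i))) i) ?_
    refine ⟨Polynomial.X ^ b i, ?_, by simp⟩
    intro j h0 hj
    rw [Polynomial.coeff_X_pow, if_neg]
    rintro rfl
    have := hb i
    simp only [intExp_apply] at this
    omega

/-- The monomial `x^β` as an element of `A(m)`. -/
noncomputable def cuspMonomial (K : Type*) [Field K] {n : ℕ} {m : Fin n → ℕ}
    (β : cuspExponents m) : multiCuspAlgebra K m :=
  ⟨monomial (natExp β.1) 1, mem_multiCuspAlgebra.2 fun b hb => by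
    classical
    rw [coeff_monomial] at hb
    have h : natExp β.1 = b := by
      by_contra h
      exact hb (if_neg h)
    rw [← h, intExp_natExp (nonneg_of_mem_cuspExponents β.2)]
    exact β.2⟩

theorem coe_cuspMonomial (β : cuspExponents m) :
    (cuspMonomial K β : MvPolynomial (Fin n) K) = monomial (natExp β.1) 1 := rfl

theorem cuspMonomial_add (β γ : cuspExponents m) :
    cuspMonomial K (β + γ) = cuspMonomial K β * cuspMonomial K γ := by
  apply Subtype.ext
  rw [MulMemClass.coe_mul, coe_cuspMonomial, coe_cuspMonomial, coe_cuspMonomial, monomial_mul,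
    one_mul, AddSubmonoid.coe_add, natExp_add (nonneg_of_mem_cuspExponents β.2)
    (nonneg_of_mem_cuspExponents γ.2)]

theorem cuspMonomial_zero : cuspMonomial K (0 : cuspExponents m) = 1 := by
  apply Subtype.ext
  have : natExp (0 : Fin n → ℤ) = 0 := by ext; simp
  rw [coe_cuspMonomial, ZeroMemClass.coe_zero, this, OneMemClass.coe_one]
  rfl

theorem mem_cuspExponents_of_intCoeff_ne_zero {a : multiCuspAlgebra K m} {γ : Fin n → ℤ}
    (h : intCoeff γ (a : MvPolynomial (Fin n) K) ≠ 0) : γ ∈ cuspExponents m := by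
  have h0 := nonneg_of_intCoeff_ne_zero h
  rw [intCoeff_of_nonneg h0] at h
  have := mem_multiCuspAlgebra.1 a.2 _ h
  rwa [intExp_natExp h0] at this

theorem multiCusp_ext {a b : multiCuspAlgebra K m}
    (h : ∀ γ ∈ cuspExponents m, intCoeff γ (a : MvPolynomial (Fin n) K) =
      intCoeff γ (b : MvPolynomial (Fin n) K)) : a = b := by
  apply Subtype.ext
  ext e
  rw [← intCoeff_intExp, ← intCoeff_intExp]
  by_cases he : intExp e ∈ cuspExponents m
  · exact h _ he
  · rw [not_not.1 (mt mem_cuspExponents_of_intCoeff_ne_zero he),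
      not_not.1 (mt mem_cuspExponents_of_intCoeff_ne_zero he)]

theorem span_cuspMonomial : Submodule.span K (Set.range (cuspMonomial K (m := m))) = ⊤ := by
  rw [eq_top_iff]
  rintro a -
  have ha : a = ∑ b ∈ a.1.support.attach,
      coeff b.1 a.1 • cuspMonomial K (m := m)
        ⟨intExp b.1, mem_multiCuspAlgebra.1 a.2 _ (mem_support_iff.1 b.2)⟩ := by
    apply Subtype.ext
    rw [AddSubmonoidClass.coe_finsetSum]
    conv_lhs => rw [a.1.as_sum, ← Finset.sum_attach]
    refine Finset.sum_congr rfl fun b _ => ?_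
    rw [SetLike.val_smul, coe_cuspMonomial, natExp_intExp, smul_monomial, smul_eq_mul, mul_one]
  rw [ha]
  exact Submodule.sum_mem _ fun b _ => Submodule.smul_mem _ _ (Submodule.subset_span ⟨_, rfl⟩)

end MultiCusp

/-! ### Coefficient functions of operators, and operators with a given symbol -/

section Operators

variable {K : Type*} [Field K] {n : ℕ} {m : Fin n → ℕ} {A : Type*} [CommRing A] [Algebra K A]
  {e : A ≃ₐ[K] multiCuspAlgebra K m}

variable (e) in
/-- The monomial `x^β` in a copy `A` of `A(m)`. -/
noncomputable def mono (β : cuspExponents m) : A := e.symm (cuspMonomial K β)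

theorem apply_mono (β : cuspExponents m) : e (mono e β) = cuspMonomial K β :=
  e.apply_symm_apply _

theorem mono_add (β γ : cuspExponents m) : mono e (β + γ) = mono e β * mono e γ := by
  rw [mono, cuspMonomial_add, map_mul]; rfl

theorem mono_zero : mono e 0 = 1 := by
  rw [mono, cuspMonomial_zero, map_one]

variable (e) in
/-- The coefficient of `x^γ` in an element of a copy of `A(m)`. -/
noncomputable def monoCoeff (γ : Fin n → ℤ) : A →ₗ[K] K :=
  intCoeff γ ∘ₗ (multiCuspAlgebra K m).val.toLinearMap ∘ₗ e.toLinearMap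

theorem monoCoeff_apply (γ : Fin n → ℤ) (a : A) :
    monoCoeff e γ a = intCoeff γ (e a : MvPolynomial (Fin n) K) := rfl

theorem monoCoeff_mono_mul (s : cuspExponents m) (γ : Fin n → ℤ) (a : A) :
    monoCoeff e (γ + s.1) (mono e s * a) = monoCoeff e γ a := by
  rw [monoCoeff_apply, map_mul, apply_mono]
  exact intCoeff_monomial_mul (nonneg_of_mem_cuspExponents s.2) _ _

theorem monoCoeff_mono [DecidableEq (Fin n → ℤ)] (γ : Fin n → ℤ) (β : cuspExponents m) :
    monoCoeff e γ (mono e β) = if γ = β.1 then 1 else 0 := by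
  rw [monoCoeff_apply, apply_mono, coe_cuspMonomial,
    intCoeff_monomial (nonneg_of_mem_cuspExponents β.2)]

theorem monoCoeff_eq_zero {γ : Fin n → ℤ} (h : γ ∉ cuspExponents m) (a : A) :
    monoCoeff e γ a = 0 :=
  not_not.1 (mt mem_cuspExponents_of_intCoeff_ne_zero h)

theorem ext_monoCoeff {a b : A} (h : ∀ γ ∈ cuspExponents m, monoCoeff e γ a = monoCoeff e γ b) :
    a = b := e.injective (multiCusp_ext h)

theorem finite_monoCoeff_ne_zero (a : A) : {γ | monoCoeff e γ a ≠ 0}.Finite :=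
  finite_intCoeff_ne_zero (e a : MvPolynomial (Fin n) K)

theorem span_mono : Submodule.span K (Set.range (mono e)) = ⊤ := by
  have : Set.range (mono e) = e.symm.toLinearMap '' Set.range (cuspMonomial K (m := m)) := by
    rw [← Set.range_comp]; rfl
  rw [this, Submodule.span_image, span_cuspMonomial, Submodule.map_top, LinearMap.range_eq_top]
  exact e.symm.surjective

theorem linearMap_ext_mono {M : Type*} [AddCommMonoid M] [Module K M] {u v : A →ₗ[K] M}
    (h : ∀ β, u (mono e β) = v (mono e β)) : u = v :=
  LinearMap.ext_on_range span_mono h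

variable (e) in
/-- The coefficient of `x^(β + α)` in `u (x^β)`. -/
noncomputable def opCoeff (α : Fin n → ℤ) (β : cuspExponents m) : Module.End K A →ₗ[K] K :=
  monoCoeff e (β.1 + α) ∘ₗ LinearMap.applyₗ (mono e β)

theorem opCoeff_apply (α : Fin n → ℤ) (β : cuspExponents m) (u : Module.End K A) :
    opCoeff e α β u = monoCoeff e (β.1 + α) (u (mono e β)) := rfl

theorem opCoeff_eq_zero {α : Fin n → ℤ} {β : cuspExponents m} (h : β.1 + α ∉ cuspExponents m)
    (u : Module.End K A) : opCoeff e α β u = 0 :=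
  monoCoeff_eq_zero h _

variable (e) in
theorem end_ext_opCoeff {u v : Module.End K A}
    (h : ∀ α β, opCoeff e α β u = opCoeff e α β v) : u = v := by
  refine linearMap_ext_mono (e := e) fun β => ext_monoCoeff (e := e) fun γ _ => ?_
  have := h (γ - β.1) β
  rwa [opCoeff_apply, opCoeff_apply, add_sub_cancel] at this

theorem finite_opCoeff_ne_zero (u : Module.End K A) (β : cuspExponents m) :
    {α | opCoeff e α β u ≠ 0}.Finite := by
  refine ((finite_monoCoeff_ne_zero (e := e) (u (mono e β))).image
    fun γ => γ - β.1).subset fun α hα => ⟨β.1 + α, hα, by simp⟩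

/-- The commutator of `a` and `u`. -/
noncomputable def adLmul (u : Module.End K A) : A →ₗ[K] Module.End K A :=
  LinearMap.mulRight K u ∘ₗ (Algebra.lmul K A).toLinearMap -
    LinearMap.mulLeft K u ∘ₗ (Algebra.lmul K A).toLinearMap

theorem adLmul_apply (u : Module.End K A) (a : A) :
    adLmul u a = Algebra.lmul K A a * u - u * Algebra.lmul K A a := rfl

theorem opCoeff_lmul_mul (u : Module.End K A) (α : Fin n → ℤ) (s β : cuspExponents m) :
    opCoeff e (α + s.1) β (Algebra.lmul K A (mono e s) * u) = opCoeff e α β u := by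
  rw [opCoeff_apply, opCoeff_apply, ← add_assoc]
  exact monoCoeff_mono_mul _ _ _

theorem opCoeff_mul_lmul (u : Module.End K A) (α : Fin n → ℤ) (s β : cuspExponents m) :
    opCoeff e (α + s.1) β (u * Algebra.lmul K A (mono e s)) = opCoeff e α (β + s) u := by
  rw [opCoeff_apply, opCoeff_apply, AddSubmonoid.coe_add, Module.End.mul_apply,
    Algebra.coe_lmul_eq_mul, LinearMap.mul_apply', ← mono_add, add_comm s β, ← add_assoc,
    add_right_comm]

/-- This is the bridge to finite differences: left multiplication by `x^s` keeps the argument `β` of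
the coefficient function, right multiplication moves it to `β + s`, and both raise the degree by
`s`. -/
theorem opCoeff_adLmul (u : Module.End K A) (α : Fin n → ℤ) (s β : cuspExponents m) :
    opCoeff e (α + s.1) β (adLmul u (mono e s)) = opCoeff e α β u - opCoeff e α (β + s) u := by
  rw [adLmul_apply, map_sub, opCoeff_lmul_mul, opCoeff_mul_lmul]

theorem isDiffOp_zero_iff {u : Module.End K A} :
    IsDiffOp K A 0 u ↔ u = Algebra.lmul K A (u 1) := by
  constructor
  · intro h
    ext a
    have := congrArg (fun w : Module.End K A => w 1) (h a)
    simp only [LinearMap.sub_apply, Module.End.mul_apply, Algebra.coe_lmul_eq_mul,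
        LinearMap.mul_apply', mul_one,
      LinearMap.zero_apply, sub_eq_zero] at this
    rw [Algebra.coe_lmul_eq_mul, LinearMap.mul_apply', mul_comm]
    exact this.symm
  · intro h
    rw [h]
    exact IsDiffOp.lmul _

theorem IsDiffOp.smul {k : ℕ} {u : Module.End K A} (c : K)
    (hu : IsDiffOp K A k u) : IsDiffOp K A k (c • u) := by
  have h := IsDiffOp.mul _ 0 k rfl (IsDiffOp.lmul (K := K) (algebraMap K A c)) hu
  rw [zero_add] at h
  convert h using 1
  ext a
  simp [Algebra.smul_def]

theorem adLmul_mem_of_mono {u : Module.End K A}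
    {W : Submodule K (Module.End K A)}
    (h : ∀ s, adLmul u (mono e s) ∈ W) (a : A) : adLmul u a ∈ W := by
  have : Submodule.span K (Set.range (mono e)) ≤ W.comap (adLmul u) := by
    rw [Submodule.span_le]
    rintro _ ⟨s, rfl⟩
    exact h s
  rw [span_mono] at this
  exact this (Submodule.mem_top (x := a))

variable (e) in
theorem isDiffOp_zero_of_mono {u : Module.End K A}
    (h : ∀ s, adLmul u (mono e s) = 0) : IsDiffOp K A 0 u :=
  fun a => (Submodule.mem_bot K).1 (adLmul_mem_of_mono (W := ⊥) h a)

variable (e) in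
theorem isDiffOp_succ_of_mono {u : Module.End K A} {k : ℕ}
    (h : ∀ s, IsDiffOp K A k (adLmul u (mono e s))) :
    IsDiffOp K A (k + 1) u :=
  fun a => adLmul_mem_of_mono
    (W := { carrier := {v | IsDiffOp K A k v}
            add_mem' := IsDiffOp.add
            zero_mem' := IsDiffOp.zero k
            smul_mem' := fun c _ => IsDiffOp.smul c }) h a

/-- The polynomial `f` vanishes at the exponents `β` for which `β + α` is not an exponent. -/
def Admissible (m : Fin n → ℕ) (α : Fin n → ℤ) (f : MvPolynomial (Fin n) K) : Prop :=
  ∀ β ∈ cuspExponents m, β + α ∉ cuspExponents m → evalInt β f = 0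

/-- The operator `x^β ↦ f(β) x^(β + α)` on all polynomials. -/
noncomputable def polyOp (α : Fin n → ℤ) (f : MvPolynomial (Fin n) K) :
    MvPolynomial (Fin n) K →ₗ[K] MvPolynomial (Fin n) K :=
  (basisMonomials (Fin n) K).constr K fun b =>
    monomial (natExp (intExp b + α)) (evalInt (intExp b) f)

theorem polyOp_monomial (α : Fin n → ℤ) (f : MvPolynomial (Fin n) K) (b : Fin n →₀ ℕ) :
    polyOp α f (monomial b 1) = monomial (natExp (intExp b + α)) (evalInt (intExp b) f) := by
  have := (basisMonomials (Fin n) K).constr_basis K (fun b =>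
    monomial (natExp (intExp b + α)) (evalInt (intExp b) f)) b
  rwa [coe_basisMonomials] at this

/-- When `β + α` is not an exponent, the monomial with exponent `natExp (β + α)`, possibly
truncated, need not lie in `A(m)`; admissibility makes its coefficient zero. -/
theorem polyOp_mem {α : Fin n → ℤ} {f : MvPolynomial (Fin n) K} (hf : Admissible m α f)
    (a : MvPolynomial (Fin n) K) (ha : a ∈ (multiCuspAlgebra K m).toSubmodule) :
    polyOp α f a ∈ (multiCuspAlgebra K m).toSubmodule := by
  classical
  rw [a.as_sum, map_sum]
  refine sum_mem fun b hb => ?_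
  have hb := mem_multiCuspAlgebra.1 ha b (mem_support_iff.1 hb)
  have : monomial b (coeff b a) = coeff b a • (monomial b 1 : MvPolynomial (Fin n) K) := by
    rw [smul_monomial, smul_eq_mul, mul_one]
  rw [this, map_smul, polyOp_monomial]
  refine Submodule.smul_mem _ _ ?_
  by_cases h : intExp b + α ∈ cuspExponents m
  · refine mem_multiCuspAlgebra.2 fun c hc => ?_
    rw [coeff_monomial] at hc
    have hbc : natExp (intExp b + α) = c := by
      by_contra h
      exact hc (if_neg h)
    rwa [← hbc, intExp_natExp (nonneg_of_mem_cuspExponents h)]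
  · rw [hf _ hb h, map_zero]
    exact zero_mem _

variable (e) in
/-- The operator `x^β ↦ f(β) x^(β + α)` on a copy of `A(m)`. -/
noncomputable def cuspOp {α : Fin n → ℤ} {f : MvPolynomial (Fin n) K} (hf : Admissible m α f) :
    Module.End K A :=
  e.symm.toLinearMap ∘ₗ (polyOp α f).restrict (polyOp_mem hf) ∘ₗ e.toLinearMap

theorem coe_apply_cuspOp_mono {α : Fin n → ℤ} {f : MvPolynomial (Fin n) K}
    (hf : Admissible m α f) (β : cuspExponents m) :
    (e (cuspOp e hf (mono e β)) : MvPolynomial (Fin n) K) =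
      monomial (natExp (β.1 + α)) (evalInt β.1 f) := by
  have : e (cuspOp e hf (mono e β)) = (polyOp α f).restrict (polyOp_mem hf) (e (mono e β)) :=
    e.apply_symm_apply _
  rw [this, apply_mono]
  change polyOp α f (monomial (natExp β.1) 1) = _
  rw [polyOp_monomial, intExp_natExp (nonneg_of_mem_cuspExponents β.2)]

theorem opCoeff_cuspOp [DecidableEq (Fin n → ℤ)] {α : Fin n → ℤ} {f : MvPolynomial (Fin n) K}
    (hf : Admissible m α f) (α' : Fin n → ℤ) (β : cuspExponents m) :
    opCoeff e α' β (cuspOp e hf) = if α' = α then evalInt β.1 f else 0 := by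
  rw [opCoeff_apply, monoCoeff_apply, coe_apply_cuspOp_mono]
  by_cases h : β.1 + α ∈ cuspExponents m
  · rw [intCoeff_monomial (nonneg_of_mem_cuspExponents h)]
    simp
  · rw [hf _ β.2 h, map_zero, map_zero]
    simp

theorem cuspOp_mono {α : Fin n → ℤ} {f : MvPolynomial (Fin n) K}
    (hf : Admissible m α f) (β : cuspExponents m) (h : β.1 + α ∈ cuspExponents m) :
    cuspOp e hf (mono e β) = evalInt β.1 f • mono e ⟨β.1 + α, h⟩ := by
  apply e.injective
  apply Subtype.ext
  rw [coe_apply_cuspOp_mono, map_smul, apply_mono, SetLike.val_smul, coe_cuspMonomial,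
    smul_monomial, smul_eq_mul, mul_one]

/-- The exponents are closed under adding `s`, so if `β + α + s` is not an exponent, then neither is
`β + α`, and `f` vanishes at both `β` and `β + s`. -/
theorem Admissible.sub_polyShift {α : Fin n → ℤ} {f : MvPolynomial (Fin n) K}
    (hf : Admissible m α f) (s : cuspExponents m) :
    Admissible m (α + s.1) (polyShift (fun i => (s.1 i : K)) f - f) := by
  intro β hβ h
  have h1 : β + α ∉ cuspExponents m := fun h' => h (by rw [← add_assoc]; exact add_mem h' s.2)
  rw [map_sub, hf β hβ h1, evalInt_polyShift, hf _ (add_mem hβ s.2), sub_zero]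
  rwa [add_assoc, add_comm s.1]

theorem adLmul_cuspOp {α : Fin n → ℤ} {f : MvPolynomial (Fin n) K} (hf : Admissible m α f)
    (s : cuspExponents m) :
    adLmul (cuspOp e hf) (mono e s) = -cuspOp e (hf.sub_polyShift s) := by
  classical
  refine end_ext_opCoeff e fun α' β => ?_
  obtain ⟨α', rfl⟩ : ∃ γ, α' = γ + s.1 := ⟨α' - s.1, by simp⟩
  rw [opCoeff_adLmul, map_neg, opCoeff_cuspOp, opCoeff_cuspOp, opCoeff_cuspOp]
  by_cases h : α' = α
  · subst h
    simp [evalInt_polyShift]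
  · simp [h]

/-- Commuting with a monomial replaces the symbol by minus a finite difference, which has smaller
degree or is zero. -/
theorem isDiffOp_cuspOp (k : ℕ) {α : Fin n → ℤ} {f : MvPolynomial (Fin n) K}
    (hf : Admissible m α f) (hk : f.totalDegree ≤ k) :
    IsDiffOp K A k (cuspOp e hf) := by
  classical
  have hzero : ∀ {α : Fin n → ℤ} {f : MvPolynomial (Fin n) K} (hf : Admissible m α f),
      f = 0 → cuspOp e hf = 0 := by
    intro α f hf h
    refine end_ext_opCoeff e fun α' β => ?_
    rw [opCoeff_cuspOp, h]
    simp
  induction k generalizing α f with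
  | zero =>
    refine isDiffOp_zero_of_mono e fun s => ?_
    rw [adLmul_cuspOp, neg_eq_zero]
    refine hzero _ ((totalDegree_polyShift_sub_lt _ _).resolve_right ?_)
    omega
  | succ k ih =>
    refine isDiffOp_succ_of_mono e fun s => ?_
    rw [adLmul_cuspOp, ← neg_one_smul K]
    refine IsDiffOp.smul _ ?_
    rcases totalDegree_polyShift_sub_lt (fun i => (s.1 i : K)) f with h | h
    · rw [hzero _ h]
      exact IsDiffOp.zero k
    · exact ih _ (by omega)

variable (e) in
/-- The operator `x^β ↦ f(β) x^(β + α)` as an element of `𝒟(A(m))`. -/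
noncomputable def cuspDiffOp {α : Fin n → ℤ} {f : MvPolynomial (Fin n) K}
    (hf : Admissible m α f) : diffOps K A :=
  ⟨cuspOp e hf, f.totalDegree, isDiffOp_cuspOp _ hf le_rfl⟩

end Operators

/-! ### Coefficient functions of differential operators are polynomial -/

section Polynomiality

variable {K : Type*} [Field K] {n : ℕ} {m : Fin n → ℕ} {A : Type*} [CommRing A] [Algebra K A]
  {e : A ≃ₐ[K] multiCuspAlgebra K m}

/-- The vector `k eᵢ` for `k` beyond the bound. -/
def cuspSingle (m : Fin n → ℕ) (i : Fin n) (k : ℕ) : cuspExponents m :=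
  ⟨Pi.single i ((cuspBound m + k : ℕ) : ℤ), mem_cuspExponents_of_le fun j => by
    by_cases h : j = i
    · subst h; right; simp
    · left; simp [h]⟩

/-- Unit vectors need not be exponents, but with `M = cuspBound m` both `M eᵢ` and `(M + 1) eᵢ` are,
and `β + ∑ βᵢ • (M eᵢ) = ∑ βᵢ • ((M + 1) eᵢ)` joins `β` to `0` by such steps. -/
theorem eq_of_forall_add_single {Y : Type*} {c : cuspExponents m → Y}
    (h : ∀ i k, k ≤ 1 → ∀ β, c (β + cuspSingle m i k) = c β) (β : cuspExponents m) :
    c β = c 0 := by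
  let Z : AddSubmonoid (cuspExponents m) :=
    { carrier := {t | ∀ β, c (β + t) = c β}
      zero_mem' := fun β => by rw [add_zero]
      add_mem' := by
        intro s t hs ht β
        rw [← add_assoc, ht, hs] }
  have hx : ∀ k ≤ 1, ∑ i, (β.1 i).toNat • cuspSingle m i k ∈ Z := fun k hk =>
    sum_mem fun i _ => nsmul_mem (show _ ∈ Z from h i k hk) _
  have h0 : β + ∑ i, (β.1 i).toNat • cuspSingle m i 0 =
      0 + ∑ i, (β.1 i).toNat • cuspSingle m i 1 := by
    apply Subtype.ext
    funext j
    have hβ := nonneg_of_mem_cuspExponents β.2 j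
    simp only [AddSubmonoid.coe_add, AddSubmonoid.coe_finsetSum, AddSubmonoidClass.coe_nsmul,
      Pi.add_apply, Finset.sum_apply, Pi.smul_apply, cuspSingle, ZeroMemClass.coe_zero]
    rw [Finset.sum_eq_single j (by intro i _ hi; simp [hi.symm]) (by simp),
      Finset.sum_eq_single j (by intro i _ hi; simp [hi.symm]) (by simp)]
    simp only [Pi.single_eq_same, nsmul_eq_mul, Int.natCast_toNat_eq_self.2 hβ, Pi.zero_apply]
    push_cast
    ring
  rw [← hx 0 (by omega) β, h0, hx 1 le_rfl 0]

/-- Far from the origin, unit differences are obtained by comparing the steps `M eᵢ` and `(M + 1)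
eᵢ` from a common base point, so `c` agrees with a polynomial `f` there. One large step `t` then
carries the equality back to all exponents. -/
theorem exists_evalInt_eq_of_differences [CharZero K] {c : cuspExponents m → K}
    (h : ∀ s : cuspExponents m, ∃ f : MvPolynomial (Fin n) K,
      ∀ β : cuspExponents m, c β - c (β + s) = evalInt β.1 f) :
    ∃ f : MvPolynomial (Fin n) K, ∀ β : cuspExponents m, c β = evalInt β.1 f := by
  choose p hp using h
  have hmem : ∀ γ : Fin n → ℤ, (∀ i, (cuspBound m : ℤ) ≤ γ i) → γ ∈ cuspExponents m :=
    fun γ hγ => mem_cuspExponents_of_le fun i => Or.inr (hγ i)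
  let M : ℤ := cuspBound m
  have hM : 0 < M := Int.natCast_pos.2 (cuspBound_pos m)
  let b : (Fin n → ℕ) → Fin n → ℤ := fun γ i => 2 * M + γ i
  have hb : ∀ γ, b γ ∈ cuspExponents m := fun γ => hmem _ fun i => by
    simp only [b]; omega
  obtain ⟨P, hP⟩ := exists_eval_eq_of_differences (fun γ => c ⟨b γ, hb γ⟩) (K := K) fun i => by
    -- The base point `γ + δ` is `b γ - M eᵢ`. The offset `2M` in `b` keeps all its coordinates at
    -- least `M`, hence makes it an exponent.
    let δ : Fin n → ℤ := (fun _ => 2 * M) - (cuspSingle m i 0).1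
    refine ⟨polyShift (fun j => (δ j : K)) (p (cuspSingle m i 0) - p (cuspSingle m i 1)),
      fun γ => ?_⟩
    have hev := evalInt_polyShift δ (fun j => (γ j : ℤ))
      (p (cuspSingle m i 0) - p (cuspSingle m i 1))
    have he : ∀ f : MvPolynomial (Fin n) K,
      evalInt (fun j => (γ j : ℤ)) f = eval (fun j => (γ j : K)) f := fun f => by simp [evalInt]
    rw [← he, hev]
    have hβ : (fun j => (γ j : ℤ)) + δ ∈ cuspExponents m := hmem _ fun j => by
      by_cases hj : j = i
      · subst hj
        simp only [δ, cuspSingle, Pi.add_apply, Pi.sub_apply, Pi.single_eq_same, M]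
        push_cast
        omega
      · simp only [δ, cuspSingle, Pi.add_apply, Pi.sub_apply, Pi.single_eq_of_ne hj, M]
        omega
    rw [map_sub, ← hp _ ⟨_, hβ⟩, ← hp _ ⟨_, hβ⟩, sub_sub_sub_cancel_left]
    congr 1
    · congr 1
      apply Subtype.ext
      funext j
      by_cases hj : j = i
      · subst hj
        simp only [b, δ, cuspSingle, AddSubmonoid.coe_add, Pi.add_apply, Pi.sub_apply,
          Pi.single_eq_same]
        push_cast
        ring
      · simp only [b, δ, cuspSingle, AddSubmonoid.coe_add, Pi.add_apply, Pi.sub_apply,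
          Pi.single_eq_of_ne hj]
        push_cast
        ring
    · congr 1
      apply Subtype.ext
      funext j
      simp only [b, δ, AddSubmonoid.coe_add, Pi.add_apply, Pi.sub_apply]
      ring
  let t : cuspExponents m := ⟨fun _ => 2 * M, hmem _ fun i => by omega⟩
  let f := polyShift (fun i => ((-t.1) i : K)) P
  have hlarge : ∀ γ : cuspExponents m, (∀ i, 2 * M ≤ γ.1 i) → c γ = evalInt γ.1 f := by
    intro γ hγ
    have h1 := hP fun i => (γ.1 i - 2 * M).toNat
    have h2 : ∀ i, (((γ.1 i - 2 * M).toNat : ℕ) : ℤ) = γ.1 i - 2 * M := fun i =>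
      Int.toNat_of_nonneg (by have := hγ i; omega)
    have h3 : (⟨b fun i => (γ.1 i - 2 * M).toNat, hb _⟩ : cuspExponents m) = γ := by
      apply Subtype.ext
      funext i
      simp only [b, h2]
      ring
    rw [h3] at h1
    rw [h1, evalInt_polyShift, evalInt]
    congr 2
    funext i
    rw [← Int.cast_natCast, h2]
    rfl
  -- Both sides give `c γ - c (γ + t)` for all large `γ`, so they agree as polynomials and hence
  -- also at small exponents.
  have hpt : p t = f - polyShift (fun i => (t.1 i : K)) f := by
    rw [← sub_eq_zero]
    refine eq_zero_of_evalInt_eq_zero (2 * cuspBound m) fun γ hγ => ?_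
    have hγ' : ∀ i, 2 * M ≤ γ i := fun i => by have := hγ i; push_cast at this; exact this
    have hγm : γ ∈ cuspExponents m := hmem _ fun i => by have := hγ' i; omega
    rw [map_sub, map_sub, evalInt_polyShift t.1 γ f, ← hp t ⟨γ, hγm⟩, hlarge ⟨γ, hγm⟩ hγ',
      hlarge (⟨γ, hγm⟩ + t) fun i => ?_, AddSubmonoid.coe_add, sub_self]
    have := hγ' i
    simp only [AddSubmonoid.coe_add, Pi.add_apply, t]
    omega
  refine ⟨f, fun β => ?_⟩
  have h1 := hp t β
  rw [hpt, map_sub, evalInt_polyShift t.1 β.1 f, hlarge (β + t) fun i => ?_, AddSubmonoid.coe_add]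
      at h1
  · exact sub_left_injective h1
  · have := nonneg_of_mem_cuspExponents β.2 i
    simp only [AddSubmonoid.coe_add, Pi.add_apply, t, Pi.zero_apply] at this ⊢
    omega

theorem opCoeff_lmul (a : A) (α : Fin n → ℤ) (β : cuspExponents m) :
    opCoeff e α β (Algebra.lmul K A a) = monoCoeff e α a := by
  rw [opCoeff_apply, Algebra.coe_lmul_eq_mul, LinearMap.mul_apply', mul_comm, add_comm]
  exact monoCoeff_mono_mul _ _ _

/-- The coefficients of a differential operator in each degree are given by a polynomial, and
only finitely many degrees occur. -/
theorem isDiffOp_opCoeff_structure [CharZero K] {k : ℕ}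
    {u : Module.End K A} (hu : IsDiffOp K A k u) :
    (∀ α, ∃ f : MvPolynomial (Fin n) K, ∀ β, opCoeff e α β u = evalInt β.1 f) ∧
      {α | ∃ β, opCoeff e α β u ≠ 0}.Finite := by
  induction k generalizing u with
  | zero =>
    rw [isDiffOp_zero_iff.1 hu]
    refine ⟨fun α => ⟨C (monoCoeff e α (u 1)), fun β => ?_⟩, ?_⟩
    · rw [opCoeff_lmul, evalInt_C]
    · simp only [opCoeff_lmul]
      exact (finite_monoCoeff_ne_zero (u 1)).subset fun α ⟨_, h⟩ => h
  | succ k ih =>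
    have ih' := fun s : cuspExponents m => ih (hu (mono e s))
    refine ⟨fun α => exists_evalInt_eq_of_differences fun s => ?_, ?_⟩
    · obtain ⟨f, hf⟩ := (ih' s).1 (α + s.1)
      exact ⟨f, fun β => by rw [← hf β, ← adLmul_apply, opCoeff_adLmul]⟩
    -- If all commutators with `M eᵢ` and `(M + 1) eᵢ` vanish in the relevant degrees, the
    -- coefficient function of degree `α` is constant, equal to its value at `β = 0`. That value is
    -- nonzero for finitely many `α` only, as `u 1` has finite support.
    · have hfin : ∀ s : cuspExponents m,
          {α | ∃ β, opCoeff e (α + s.1) β (adLmul u (mono e s)) ≠ 0}.Finite := fun s =>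
        ((ih' s).2.image fun α => α - s.1).subset fun α hα => ⟨α + s.1, hα, by simp⟩
      refine ((Set.finite_iUnion fun i => Set.finite_iUnion fun k : Fin 2 =>
        hfin (cuspSingle m i k)).union (finite_opCoeff_ne_zero (e := e) u 0)).subset ?_
      rintro α ⟨β, hβ⟩
      by_contra hα
      simp only [Set.mem_union, Set.mem_iUnion, Set.mem_ofPred_eq, not_or, not_exists,
        not_not, opCoeff_adLmul] at hα
      refine hβ ((eq_of_forall_add_single (c := fun β => opCoeff e α β u) ?_ β).trans hα.2)
      intro i k hk β
      exact (sub_eq_zero.1 (hα.1 i ⟨k, by omega⟩ β)).symm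

end Polynomiality

/-! ### The symbol calculus -/

section Symbols

variable {K : Type*} [Field K] [CharZero K] {n : ℕ} {m : Fin n → ℕ} {A : Type*} [CommRing A]
  [Algebra K A] {e : A ≃ₐ[K] multiCuspAlgebra K m}

variable (e) in
theorem exists_symbol (α : Fin n → ℤ) (u : diffOps K A) : ∃ f : MvPolynomial (Fin n) K,
    ∀ β : cuspExponents m, opCoeff e α β u.1 = evalInt β.1 f :=
  (isDiffOp_opCoeff_structure u.2.choose_spec).1 α

variable (e) in
/-- The polynomial `f` such that the component of degree `α` of `u` is `x^β ↦ f(β) x^(β + α)`. -/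
noncomputable def symbol (α : Fin n → ℤ) : diffOps K A →ₗ[K] MvPolynomial (Fin n) K where
  toFun u := (exists_symbol e α u).choose
  -- The chosen polynomials are unique, hence depend linearly on the operator.
  map_add' u v := by
    refine eq_of_evalInt_eq (m := m) fun β hβ => ?_
    rw [map_add, ← (exists_symbol e α _).choose_spec ⟨β, hβ⟩,
      ← (exists_symbol e α _).choose_spec ⟨β, hβ⟩, ← (exists_symbol e α _).choose_spec ⟨β, hβ⟩]
    exact map_add _ _ _
  map_smul' c u := by
    refine eq_of_evalInt_eq (m := m) fun β hβ => ?_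
    rw [RingHom.id_apply, smul_eq_C_mul, map_mul, evalInt_C,
      ← (exists_symbol e α _).choose_spec ⟨β, hβ⟩, ← (exists_symbol e α _).choose_spec ⟨β, hβ⟩]
    exact map_smul (opCoeff e α ⟨β, hβ⟩) c u.1

theorem evalInt_symbol (α : Fin n → ℤ) (u : diffOps K A) (β : cuspExponents m) :
    evalInt β.1 (symbol e α u) = opCoeff e α β u.1 :=
  ((exists_symbol e α u).choose_spec β).symm

theorem symbol_eq_of_opCoeff {α : Fin n → ℤ} {u : diffOps K A} {f : MvPolynomial (Fin n) K}
    (h : ∀ β : cuspExponents m, opCoeff e α β u.1 = evalInt β.1 f) : symbol e α u = f :=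
  eq_of_evalInt_eq (m := m) fun β hβ => by rw [evalInt_symbol α u ⟨β, hβ⟩, h]

theorem ext_symbol {u v : diffOps K A} (h : ∀ α, symbol e α u = symbol e α v) : u = v :=
  Subtype.ext <| end_ext_opCoeff e fun α β => by
    rw [← evalInt_symbol, ← evalInt_symbol, h]

theorem finite_symbol_ne_zero (u : diffOps K A) : {α | symbol e α u ≠ 0}.Finite := by
  refine (isDiffOp_opCoeff_structure (e := e) u.2.choose_spec).2.subset fun α hα => ?_
  by_contra h
  simp only [Set.mem_ofPred_eq, not_exists, not_not] at h
  exact hα (symbol_eq_of_opCoeff fun β => by rw [h, map_zero])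

theorem admissible_symbol (α : Fin n → ℤ) (u : diffOps K A) : Admissible m α (symbol e α u) :=
  fun β hβ h => by rw [evalInt_symbol α u ⟨β, hβ⟩, opCoeff_eq_zero h]

theorem symbol_cuspDiffOp [DecidableEq (Fin n → ℤ)] {α : Fin n → ℤ} {f : MvPolynomial (Fin n) K}
    (hf : Admissible m α f) (γ : Fin n → ℤ) :
    symbol e γ (cuspDiffOp e hf) = if γ = α then f else 0 := by
  refine symbol_eq_of_opCoeff fun β => ?_
  rw [cuspDiffOp, opCoeff_cuspOp]
  split_ifs <;> simp

/-- A differential operator is the sum of its homogeneous components. -/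
theorem eq_sum_cuspDiffOp (u : diffOps K A) {F : Finset (Fin n → ℤ)}
    (hF : ∀ α, symbol e α u ≠ 0 → α ∈ F) :
    u = ∑ α ∈ F, cuspDiffOp e (admissible_symbol (e := e) α u) := by
  classical
  refine ext_symbol (e := e) fun γ => ?_
  rw [map_sum]
  simp only [symbol_cuspDiffOp]
  rw [Finset.sum_ite_eq]
  split_ifs with h
  · rfl
  · exact not_not.1 (mt (hF γ) h)

/-- The right factor moves `x^β` to `x^(β + α)` before `u` acts, whence the shift by `α`. If `β + α`
is not an exponent, both sides vanish at `β` because `f(β) = 0`. -/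
theorem symbol_mul_cuspDiffOp (u : diffOps K A) {α : Fin n → ℤ} {f : MvPolynomial (Fin n) K}
    (hf : Admissible m α f) (γ : Fin n → ℤ) :
    symbol e γ (u * cuspDiffOp e hf) =
      polyShift (fun i => (α i : K)) (symbol e (γ - α) u) * f := by
  refine symbol_eq_of_opCoeff fun β => ?_
  rw [map_mul, evalInt_polyShift]
  change monoCoeff e (β.1 + γ) (u.1 (cuspOp e hf (mono e β))) = _
  by_cases h : β.1 + α ∈ cuspExponents m
  · rw [cuspOp_mono hf β h, map_smul, map_smul, smul_eq_mul, mul_comm,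
      evalInt_symbol (γ - α) u ⟨β.1 + α, h⟩, opCoeff_apply]
    congr 2
    rw [add_assoc, add_sub_cancel]
  · rw [hf _ β.2 h, mul_zero]
    have : cuspOp e hf (mono e β) = 0 := by
      apply e.injective
      apply Subtype.ext
      rw [coe_apply_cuspOp_mono, hf _ β.2 h]
      simp
    rw [this, map_zero, map_zero]

theorem symbol_mul (u v : diffOps K A) {F : Finset (Fin n → ℤ)}
    (hF : ∀ α, symbol e α v ≠ 0 → α ∈ F) (γ : Fin n → ℤ) :
    symbol e γ (u * v) = ∑ α ∈ F,
      polyShift (fun i => (α i : K)) (symbol e (γ - α) u) * symbol e α v := by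
  conv_lhs => rw [eq_sum_cuspDiffOp (e := e) v hF, Finset.mul_sum, map_sum]
  exact Finset.sum_congr rfl fun α _ => symbol_mul_cuspDiffOp _ _ _

end Symbols

/-! ### Polynomials defining the lowering operators -/

section LowerPoly

/-- The least natural number congruent to `r` modulo `N` that is zero or at least `k`, for
`r < N` and `k ≤ N`. -/
def lowerRoot (k N r : ℕ) : ℕ := if r = 0 ∨ k ≤ r then r else r + N

/-- The polynomial with the roots `lowerRoot k N r`. -/
noncomputable def lowerPoly (K : Type*) [Field K] (k N : ℕ) : Polynomial K :=
  ∏ r ∈ Finset.range N, (Polynomial.X - Polynomial.C (lowerRoot k N r : K))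

variable {K : Type*} [Field K] {n : ℕ}

theorem lowerPoly_monic (k N : ℕ) : (lowerPoly K k N).Monic :=
  Polynomial.monic_prod_of_monic _ _ fun _ _ => Polynomial.monic_X_sub_C _

theorem natDegree_lowerPoly (k N : ℕ) : (lowerPoly K k N).natDegree = N := by
  rw [lowerPoly, Polynomial.natDegree_prod_of_monic _ _ fun _ _ => Polynomial.monic_X_sub_C _]
  simp only [Polynomial.natDegree_X_sub_C, Finset.sum_const, Finset.card_range, smul_eq_mul,
      mul_one]

theorem coeff_aeval_X (i : Fin n) (q : Polynomial K) (d : Fin n →₀ ℕ) :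
    coeff d (Polynomial.aeval (X i : MvPolynomial (Fin n) K) q) =
      if d = Finsupp.single i (d i) then q.coeff (d i) else 0 := by
  classical
  rw [Polynomial.aeval_eq_sum_range, coeff_sum]
  simp only [coeff_smul, coeff_X_pow, smul_eq_mul, mul_ite, mul_one, mul_zero]
  split_ifs with h
  · have : ∀ j, (Finsupp.single i j = d) ↔ j = d i := fun j =>
      ⟨fun hj => by rw [← hj]; simp, fun hj => by rw [hj]; exact h.symm⟩
    simp only [this, Finset.sum_ite_eq', Finset.mem_range]
    split_ifs with h'
    · rfl
    · exact (Polynomial.coeff_eq_zero_of_natDegree_lt (by omega)).symm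
  · refine Finset.sum_eq_zero fun j _ => if_neg fun hj => h ?_
    rw [← hj]; simp

theorem evalInt_aeval_X (β : Fin n → ℤ) (i : Fin n) (q : Polynomial K) :
    evalInt β (Polynomial.aeval (X i : MvPolynomial (Fin n) K) q) = q.eval (β i : K) := by
  rw [evalInt, ← aeval_eq_eval]
  rw [← Polynomial.aeval_algHom_apply, aeval_X, Polynomial.coe_aeval_eq_eval]

theorem admissible_lowerPoly {m : Fin n → ℕ} (i : Fin n) {N : ℕ} (hN : m i ≤ N) :
    Admissible m (-Pi.single i (N : ℤ))
      (Polynomial.aeval (X i : MvPolynomial (Fin n) K) (lowerPoly K (m i) N)) := by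
  intro β hβ h
  have hi := hβ i
  have hbad : ¬(β i - N = 0 ∨ (0 < β i - N ∧ (m i : ℤ) ≤ β i - N)) := by
    intro hgood
    refine h fun j => ?_
    by_cases hj : j = i
    · subst hj
      simpa [sub_eq_add_neg] using! hgood
    · simpa [hj] using! hβ j
  -- If `β i < N`, it is its own residue. Otherwise `β i - N` is a gap strictly between `0` and `m i
  -- ≤ N`, so it is the residue, and the root is `r + N`.
  have hr : ∃ r ∈ Finset.range N, (lowerRoot (m i) N r : ℤ) = β i := by
    by_cases hlt : β i < N
    · refine ⟨(β i).toNat, ?_, ?_⟩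
      · rw [Finset.mem_range]; omega
      · rw [lowerRoot, if_pos (by omega)]; omega
    · refine ⟨(β i - N).toNat, ?_, ?_⟩
      · rw [Finset.mem_range]; omega
      · rw [lowerRoot, if_neg (by omega)]; omega
  obtain ⟨r, hr, hroot⟩ := hr
  rw [evalInt_aeval_X, lowerPoly, Polynomial.eval_prod]
  refine Finset.prod_eq_zero hr ?_
  rw [← hroot]
  simp

end LowerPoly

/-! ### An additive total order on exponents -/

section ExponentOrder

variable {ι : Type*} [Fintype ι] {N : ℕ}

/-- The total weight, refined lexicographically. -/
def weightLex (t : ι ≃ Fin N) : (ι → ℤ) →+ ℤ ×ₗ Lex (Fin N → ℤ) where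
  toFun g := toLex (∑ i, g i, toLex (g ∘ t.symm))
  map_zero' := by
    simp only [Pi.zero_apply, Finset.sum_const_zero]
    rfl
  map_add' g h := by
    simp only [Pi.add_apply, Finset.sum_add_distrib]
    rfl

theorem weightLex_injective (t : ι ≃ Fin N) : Function.Injective (weightLex t) := by
  intro g h hgh
  have h1 : toLex (g ∘ t.symm) = toLex (h ∘ t.symm) :=
    congrArg (fun x : ℤ ×ₗ Lex (Fin N → ℤ) => (ofLex x).2) hgh
  exact (t.symm.surjective.injective_comp_right) (toLex.injective h1)

theorem weightLex_lt_of_sum_lt (t : ι ≃ Fin N) {g h : ι → ℤ} (hgh : ∑ i, g i < ∑ i, h i) :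
    weightLex t g < weightLex t h :=
  Prod.Lex.toLex_lt_toLex.2 (Or.inl hgh)

theorem weightLex_strictMono (t : ι ≃ Fin N) : StrictMono (weightLex t) := by
  intro g h hgh
  obtain ⟨hle, i, hi⟩ := Pi.lt_def.1 hgh
  exact weightLex_lt_of_sum_lt t (Finset.sum_lt_sum (fun j _ => hle j) ⟨i, Finset.mem_univ i, hi⟩)

end ExponentOrder

/-! ### Leading terms of products -/

section LeadingTerms

variable {K : Type*} [Field K] [CharZero K] {n : ℕ} {m : Fin n → ℕ} {A : Type*} [CommRing A]
  [Algebra K A] {e : A ≃ₐ[K] multiCuspAlgebra K m}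

/-- The degree `α` of the term with exponents `g` in `x` and its dual variable. -/
def degPart (g : Fin n ⊕ Fin n → ℤ) : Fin n → ℤ := fun i => g (Sum.inl i) - g (Sum.inr i)

/-- The polynomial exponent of the term with exponents `g`. -/
def polPart (g : Fin n ⊕ Fin n → ℤ) : Fin n → ℤ := fun i => g (Sum.inr i)

/-- The exponents of the term of degree `α` with polynomial exponent `δ`. -/
def mkExp (α δ : Fin n → ℤ) : Fin n ⊕ Fin n → ℤ := Sum.elim (α + δ) δ

@[simp] theorem degPart_mkExp (α δ : Fin n → ℤ) : degPart (mkExp α δ) = α := by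
  funext i; simp [degPart, mkExp]

@[simp] theorem polPart_mkExp (α δ : Fin n → ℤ) : polPart (mkExp α δ) = δ := rfl

@[simp] theorem mkExp_degPart_polPart (g : Fin n ⊕ Fin n → ℤ) :
    mkExp (degPart g) (polPart g) = g := by
  funext i
  cases i <;> simp [degPart, polPart, mkExp]

theorem mkExp_add (α α' δ δ' : Fin n → ℤ) :
    mkExp (α + α') (δ + δ') = mkExp α δ + mkExp α' δ' := by
  funext i
  cases i <;> simp [mkExp]
  ring

theorem mkExp_lt_mkExp (α : Fin n → ℤ) {δ δ' : Fin n → ℤ} (h : δ < δ') :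
    mkExp α δ < mkExp α δ' := by
  obtain ⟨hle, i, hi⟩ := Pi.lt_def.1 h
  refine Pi.lt_def.2 ⟨fun j => ?_, Sum.inr i, hi⟩
  cases j with
  | inl j => simpa [mkExp] using hle j
  | inr j => exact hle j

theorem mkExp_le_mkExp (α : Fin n → ℤ) {δ δ' : Fin n → ℤ} (h : δ ≤ δ') :
    mkExp α δ ≤ mkExp α δ' := by
  intro j
  cases j with
  | inl j => simpa [mkExp] using h j
  | inr j => exact h j

theorem sum_mkExp (α δ : Fin n → ℤ) : ∑ i, mkExp α δ i = ∑ i, α i + 2 * ∑ i, δ i := by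
  rw [Fintype.sum_sum_type]
  simp only [mkExp, Sum.elim_inl, Sum.elim_inr, Pi.add_apply, Finset.sum_add_distrib]
  ring

variable (e) in
/-- The coefficients of the symbols of a differential operator. -/
noncomputable def expCoeff : diffOps K A →ₗ[K] ((Fin n ⊕ Fin n → ℤ) → K) :=
  LinearMap.pi fun g => intCoeff (polPart g) ∘ₗ symbol e (degPart g)

theorem expCoeff_apply (u : diffOps K A) (g : Fin n ⊕ Fin n → ℤ) :
    expCoeff e u g = intCoeff (polPart g) (symbol e (degPart g) u) := rfl

theorem expCoeff_mkExp (u : diffOps K A) (α : Fin n → ℤ) (d : Fin n →₀ ℕ) :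
    expCoeff e u (mkExp α (intExp d)) = coeff d (symbol e α u) := by
  rw [expCoeff_apply, degPart_mkExp, polPart_mkExp, intCoeff_intExp]

theorem expCoeff_injective : Function.Injective (expCoeff e) := by
  intro u v h
  refine ext_symbol (e := e) fun α => ?_
  ext d
  rw [← expCoeff_mkExp, h, expCoeff_mkExp]

theorem finite_expCoeff_ne_zero (u : diffOps K A) : {g | expCoeff e u g ≠ 0}.Finite := by
  refine ((finite_symbol_ne_zero (e := e) u).biUnion fun α _ =>
    (finite_intCoeff_ne_zero (symbol e α u)).image (mkExp α)).subset fun g hg => ?_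
  refine Set.mem_biUnion (x := degPart g) (fun h => hg ?_) ⟨polPart g, hg, by simp⟩
  rw [expCoeff_apply, h, map_zero]

theorem expCoeff_cuspDiffOp [DecidableEq (Fin n → ℤ)] {α : Fin n → ℤ}
    {f : MvPolynomial (Fin n) K} (hf : Admissible m α f) (g : Fin n ⊕ Fin n → ℤ) :
    expCoeff e (cuspDiffOp e hf) g = if degPart g = α then intCoeff (polPart g) f else 0 := by
  rw [expCoeff_apply, symbol_cuspDiffOp]
  split_ifs <;> simp

theorem intExp_lt_intExp {c d : Fin n →₀ ℕ} (h : c < d) : intExp c < intExp d := by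
  refine lt_of_le_of_ne (fun i => ?_) fun he => h.ne (intExp_injective he)
  exact Int.ofNat_le.2 (h.le i)

theorem intExp_le_intExp {c d : Fin n →₀ ℕ} (h : c ≤ d) : intExp c ≤ intExp d :=
  fun i => Int.ofNat_le.2 (h i)

section Mul

variable {Γ : Type*} [AddCommGroup Γ] [LinearOrder Γ] [IsOrderedAddMonoid Γ]
  {ω : (Fin n ⊕ Fin n → ℤ) →+ Γ}

/-- A nonzero contribution at `g` splits `g` into two exponents. The first is at most `a`, because a
shift only creates terms below existing ones; the second is at most `b`. As `g` is not below `a +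
b`, both bounds are equalities. -/
theorem eq_of_shifted_coeff_mul_ne_zero (hω : Function.Injective ω) (hmono : StrictMono ω)
    {u v : diffOps K A} {a b g : Fin n ⊕ Fin n → ℤ} (hu : ∀ g, ω a < ω g → expCoeff e u g = 0)
    (hv : ∀ g, ω b < ω g → expCoeff e v g = 0) (hg : ω (a + b) ≤ ω g) {α : Fin n → ℤ}
    {c d : Fin n →₀ ℕ} (hcd : intExp (c + d) = polPart g)
    (h : coeff c (polyShift (fun i => (α i : K)) (symbol e (degPart g - α) u)) *
      coeff d (symbol e α v) ≠ 0) :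
    g = a + b ∧ a = mkExp (degPart g - α) (intExp c) ∧ b = mkExp α (intExp d) := by
  obtain ⟨c', hc', hle⟩ := exists_le_of_coeff_polyShift_ne_zero _ _ _ (left_ne_zero_of_mul h)
  have ha : ω (mkExp (degPart g - α) (intExp c')) ≤ ω a := by
    by_contra hlt
    exact hc' ((expCoeff_mkExp u _ _).symm.trans (hu _ (not_le.1 hlt)))
  have hb : ω (mkExp α (intExp d)) ≤ ω b := by
    by_contra hlt
    exact right_ne_zero_of_mul h ((expCoeff_mkExp v _ _).symm.trans (hv _ (not_le.1 hlt)))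
  have hgsum : g = mkExp (degPart g - α) (intExp c) + mkExp α (intExp d) := by
    rw [← mkExp_add, sub_add_cancel, ← intExp_add, hcd, mkExp_degPart_polPart]
  have hc : ω (mkExp (degPart g - α) (intExp c)) ≤ ω (mkExp (degPart g - α) (intExp c')) :=
    hmono.monotone (mkExp_le_mkExp _ (intExp_le_intExp hle))
  have hω1 : ω g = ω (mkExp (degPart g - α) (intExp c)) + ω (mkExp α (intExp d)) := by
    rw [← map_add, ← hgsum]
  rw [map_add] at hg
  have h1 : ω (mkExp (degPart g - α) (intExp c)) = ω a := by
    refine le_antisymm (hc.trans ha) ?_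
    by_contra hlt
    exact absurd (hg.trans_eq hω1) (not_le.2 (add_lt_add_of_lt_of_le (not_le.1 hlt) hb))
  have h2 : ω (mkExp α (intExp d)) = ω b := by
    refine le_antisymm hb ?_
    by_contra hlt
    exact absurd (hg.trans_eq hω1) (not_le.2 (add_lt_add_of_le_of_lt (hc.trans ha) (not_le.1 hlt)))
  have h1' := hω h1
  have h2' := hω h2
  exact ⟨by rw [hgsum, h1', h2'], h1'.symm, h2'.symm⟩

theorem expCoeff_mul_eq_sum (u v : diffOps K A) {F : Finset (Fin n → ℤ)}
    (hF : ∀ α, symbol e α v ≠ 0 → α ∈ F) {g : Fin n ⊕ Fin n → ℤ} (hg : 0 ≤ polPart g) :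
    expCoeff e (u * v) g = ∑ α ∈ F, ∑ x ∈ Finset.HasAntidiagonal.antidiagonal (natExp (polPart g)),
      coeff x.1 (polyShift (fun i => (α i : K)) (symbol e (degPart g - α) u)) *
        coeff x.2 (symbol e α v) := by
  classical
  rw [expCoeff_apply, intCoeff_of_nonneg hg, symbol_mul u v hF, coeff_sum]
  exact Finset.sum_congr rfl fun α _ => coeff_mul _ _ _

theorem expCoeff_mul_of_lt (hω : Function.Injective ω) (hmono : StrictMono ω)
    {u v : diffOps K A} {a b g : Fin n ⊕ Fin n → ℤ} (hu : ∀ g, ω a < ω g → expCoeff e u g = 0)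
    (hv : ∀ g, ω b < ω g → expCoeff e v g = 0) (hg : ω (a + b) < ω g) :
    expCoeff e (u * v) g = 0 := by
  by_cases h0 : 0 ≤ polPart g
  · rw [expCoeff_mul_eq_sum u v (F := (finite_symbol_ne_zero (e := e) v).toFinset)
      (fun α hα => by simpa using hα) h0]
    refine Finset.sum_eq_zero fun α _ => Finset.sum_eq_zero fun x hx => ?_
    by_contra hne
    rw [Finset.HasAntidiagonal.mem_antidiagonal] at hx
    have := (eq_of_shifted_coeff_mul_ne_zero hω hmono hu hv hg.le
      (by rw [hx, intExp_natExp h0]) hne).1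
    exact hg.ne (by rw [this])
  · rw [expCoeff_apply, intCoeff_of_not_nonneg h0]

theorem expCoeff_mul_add (hω : Function.Injective ω) (hmono : StrictMono ω)
    {u v : diffOps K A} {a b : Fin n ⊕ Fin n → ℤ} (hu : ∀ g, ω a < ω g → expCoeff e u g = 0)
    (hv : ∀ g, ω b < ω g → expCoeff e v g = 0) :
    expCoeff e (u * v) (a + b) = expCoeff e u a * expCoeff e v b := by
  classical
  have hdeg : degPart (a + b) = degPart a + degPart b := by
    funext i; simp only [degPart, Pi.add_apply]; ring
  have hpol : polPart (a + b) = polPart a + polPart b := rfl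
  by_cases h0 : 0 ≤ polPart (a + b)
  swap
  · rw [expCoeff_apply, intCoeff_of_not_nonneg h0]
    by_cases ha : 0 ≤ polPart a
    · have hb : ¬ 0 ≤ polPart b := fun hb => h0 (add_nonneg ha hb)
      rw [expCoeff_apply v, intCoeff_of_not_nonneg hb, mul_zero]
    · rw [expCoeff_apply u, intCoeff_of_not_nonneg ha, zero_mul]
  -- The degree of `b` is inserted so that its summand is present even when the symbol of `v`
  -- vanishes there.
  let F := insert (degPart b) (finite_symbol_ne_zero (e := e) v).toFinset
  rw [expCoeff_mul_eq_sum u v (F := F) (fun α hα => Finset.mem_insert_of_mem (by simpa using hα))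
      h0]
  have key : ∀ α, ∀ x ∈ Finset.HasAntidiagonal.antidiagonal (natExp (polPart (a + b))),
      coeff x.1 (polyShift (fun i => (α i : K)) (symbol e (degPart (a + b) - α) u)) *
        coeff x.2 (symbol e α v) ≠ 0 →
      a = mkExp (degPart (a + b) - α) (intExp x.1) ∧ b = mkExp α (intExp x.2) := by
    intro α x hx hne
    rw [Finset.HasAntidiagonal.mem_antidiagonal] at hx
    exact (eq_of_shifted_coeff_mul_ne_zero hω hmono hu hv le_rfl
      (by rw [hx, intExp_natExp h0]) hne).2
  by_cases hab : 0 ≤ polPart a ∧ 0 ≤ polPart b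
  · obtain ⟨ha, hb⟩ := hab
    rw [Finset.sum_eq_single (degPart b), Finset.sum_eq_single (natExp (polPart a), natExp
        (polPart b))]
    · rw [hdeg, add_sub_cancel_right, expCoeff_apply, expCoeff_apply, intCoeff_of_nonneg ha,
        intCoeff_of_nonneg hb]
      congr 1
      -- The shift alters this coefficient only through strictly larger exponents of the same
      -- symbol, which lie above `a` and so do not occur in `u`.
      rw [← sub_eq_zero, ← coeff_sub]
      by_contra hne
      obtain ⟨c, hc, hlt⟩ := exists_lt_of_coeff_polyShift_sub_ne_zero _ _ _ hne
      refine hc ((expCoeff_mkExp u _ _).symm.trans (hu _ ?_))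
      have := mkExp_lt_mkExp (degPart a) (intExp_lt_intExp hlt)
      rw [intExp_natExp ha, mkExp_degPart_polPart] at this
      exact hmono this
    · intro x hx hne
      by_contra h
      obtain ⟨h1, h2⟩ := key _ x hx h
      refine hne (Prod.ext ?_ ?_)
      · rw [h1, polPart_mkExp, natExp_intExp]
      · conv_rhs => rw [h2]
        rw [polPart_mkExp, natExp_intExp]
    · intro h
      refine absurd (Finset.HasAntidiagonal.mem_antidiagonal.2 ?_) h
      rw [hpol, natExp_add ha hb]
    · intro α _ hα
      refine Finset.sum_eq_zero fun x hx => ?_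
      by_contra h
      obtain ⟨-, h2⟩ := key α x hx h
      exact hα (by rw [h2, degPart_mkExp])
    · intro h
      exact absurd (Finset.mem_insert_self _ _) h
  · have hzero : expCoeff e u a * expCoeff e v b = 0 := by
      rw [not_and_or] at hab
      rcases hab with h | h
      · rw [expCoeff_apply u, intCoeff_of_not_nonneg h, zero_mul]
      · rw [expCoeff_apply v, intCoeff_of_not_nonneg h, mul_zero]
    rw [hzero]
    refine Finset.sum_eq_zero fun α _ => Finset.sum_eq_zero fun x hx => ?_
    by_contra h
    obtain ⟨h1, h2⟩ := key α x hx h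
    refine hab ⟨?_, ?_⟩
    · rw [h1, polPart_mkExp]; exact intExp_nonneg _
    · rw [h2, polPart_mkExp]; exact intExp_nonneg _

end Mul

end LeadingTerms

/-! ### Nonnegativity and periodicity of the leading exponents -/

section Leads

variable {K : Type*} [Field K] [CharZero K] {n : ℕ} {m : Fin n → ℕ} {A : Type*} [CommRing A]
  [Algebra K A] {e : A ≃ₐ[K] multiCuspAlgebra K m}

/-- Translation by `-N` moves at least `N` elements of `{0} ∪ [k, ∞)` out of this set. -/
theorem exists_finset_of_translation (k N : ℕ) (hN : 0 < N) : ∃ B : Finset ℤ, B.card = N ∧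
    ∀ x ∈ B, (x = 0 ∨ (0 < x ∧ (k : ℤ) ≤ x)) ∧ ¬(x - N = 0 ∨ (0 < x - N ∧ (k : ℤ) ≤ x - N)) := by
  have hex : ∀ r : Fin N, ∃ j : ℕ, ((r : ℤ) + j * N = 0 ∨
      (0 < (r : ℤ) + j * N ∧ (k : ℤ) ≤ (r : ℤ) + j * N)) := by
    intro r
    refine ⟨k + 1, Or.inr ⟨?_, ?_⟩⟩
    · positivity
    · push_cast
      nlinarith [(Int.natCast_nonneg (r : ℕ) : (0 : ℤ) ≤ (r : ℕ)), Int.natCast_nonneg k,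
        Int.natCast_pos.2 hN]
  classical
  -- The least element of the set in each residue class modulo `N`: subtracting `N` leaves the set
  -- by minimality.
  let b : Fin N → ℤ := fun r => r + (Nat.find (hex r) : ℤ) * N
  have hinj : Function.Injective b := by
    intro r s hrs
    have h : (r : ℤ) % N = (s : ℤ) % N := by
      have := congrArg (· % (N : ℤ)) hrs
      simpa [b] using this
    rw [Int.emod_eq_of_lt (Int.natCast_nonneg _) (by exact_mod_cast r.2),
      Int.emod_eq_of_lt (Int.natCast_nonneg _) (by exact_mod_cast s.2)] at h
    exact Fin.ext (by exact_mod_cast h)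
  refine ⟨Finset.univ.image b, ?_, ?_⟩
  · rw [Finset.card_image_of_injective _ hinj, Finset.card_univ, Fintype.card_fin]
  · intro x hx
    obtain ⟨r, -, rfl⟩ := Finset.mem_image.1 hx
    refine ⟨Nat.find_spec (hex r), fun h => ?_⟩
    rcases Nat.eq_zero_or_pos (Nat.find (hex r)) with h0 | h0
    · have hr := r.2
      simp only [b, h0] at h
      push_cast at h
      omega
    · refine Nat.find_min (hex r) (Nat.sub_lt h0 one_pos) ?_
      have hb : b r - N = r + ((Nat.find (hex r) - 1 : ℕ) : ℤ) * N := by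
        rw [Nat.cast_pred h0]
        simp only [b]
        ring
      rwa [hb] at h

/-- The weight of `mkExp α δ` is `|α| + 2|δ|`, so for fixed `α` a term of higher degree would have a
larger exponent. -/
theorem degree_le_of_leading {N : ℕ} (t : Fin n ⊕ Fin n ≃ Fin N) {u : diffOps K A}
    {α : Fin n → ℤ} {d : Fin n →₀ ℕ}
    (hmax : ∀ g, weightLex t (mkExp α (intExp d)) < weightLex t g → expCoeff e u g = 0) :
    (symbol e α u).totalDegree ≤ d.degree := by
  refine Finset.sup_le fun c hc => ?_
  change c.degree ≤ d.degree
  by_contra hlt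
  refine mem_support_iff.1 hc ((expCoeff_mkExp u _ _).symm.trans (hmax _ ?_))
  refine weightLex_lt_of_sum_lt t ?_
  rw [sum_mkExp, sum_mkExp]
  have h : ∀ d : Fin n →₀ ℕ, ∑ i, intExp d i = (d.degree : ℤ) := fun d => by
    rw [Finsupp.degree_eq_sum]; simp
  rw [h, h]
  have : (d.degree : ℤ) < c.degree := by exact_mod_cast not_le.1 hlt
  omega

/-- If `α i + d i < 0`, translation by `α i` pushes at least `-α i > d i` admissible values out in
the direction `i`. The symbol then vanishes on a grid with more than `d j` points in each direction
`j`, although `d` is a top-degree exponent of it: this contradicts the combinatorial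
Nullstellensatz. -/
theorem nonneg_of_leading {N : ℕ} (t : Fin n ⊕ Fin n ≃ Fin N) {u : diffOps K A}
    {a : Fin n ⊕ Fin n → ℤ} (ha : expCoeff e u a ≠ 0)
    (hmax : ∀ g, weightLex t a < weightLex t g → expCoeff e u g = 0) : 0 ≤ a := by
  classical
  obtain ⟨α, d, rfl⟩ : ∃ (α : Fin n → ℤ) (d : Fin n →₀ ℕ), a = mkExp α (intExp d) := by
    refine ⟨degPart a, natExp (polPart a), ?_⟩
    rw [intExp_natExp (nonneg_of_intCoeff_ne_zero ha), mkExp_degPart_polPart]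
  rw [expCoeff_mkExp] at ha
  have htot : (symbol e α u).totalDegree = d.degree :=
    le_antisymm (degree_le_of_leading t hmax) (le_totalDegree (mem_support_iff.2 ha))
  suffices h : ∀ i, 0 ≤ α i + d i by
    intro j
    cases j with
    | inl i => exact h i
    | inr i => exact Int.natCast_nonneg (d i)
  intro i
  by_contra hneg
  have hN : 0 < (-α i).toNat := by omega
  obtain ⟨B, hcard, hB⟩ := exists_finset_of_translation (m i) (-α i).toNat hN
  have hNα : ((-α i).toNat : ℤ) = -α i := Int.toNat_of_nonneg (by omega)
  -- In the other directions any `d j + 1` values beyond the bound will do.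
  let S : Fin n → Finset ℤ := fun j =>
    if j = i then B else (Finset.range (d j + 1)).image fun k : ℕ => ((cuspBound m + k : ℕ) : ℤ)
  have hS : ∀ j, d j < (S j).card := by
    intro j
    by_cases hj : j = i
    · subst hj
      simp only [S, if_pos rfl, hcard]
      omega
    · simp only [S, if_neg hj]
      rw [Finset.card_image_of_injective _ (fun a b h => by
        have : cuspBound m + a = cuspBound m + b := by exact_mod_cast h
        omega), Finset.card_range]
      omega
  obtain ⟨x, hx, hne⟩ := combinatorial_nullstellensatz_exists_eval_nonzero (symbol e α u) d ha htot
    (fun j => (S j).image (Int.cast : ℤ → K)) fun j => by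
      rw [Finset.card_image_of_injective _ Int.cast_injective]
      exact hS j
  choose β hβ hβx using fun j => Finset.mem_image.1 (hx j)
  obtain rfl : (fun j => (β j : K)) = x := funext hβx
  have hβi : β i ∈ B := by simpa [S] using hβ i
  refine hne (admissible_symbol α u β (fun j => ?_) fun h => ?_)
  · by_cases hj : j = i
    · subst hj
      exact (hB _ hβi).1
    · have hβj := hβ j
      simp only [S, if_neg hj] at hβj
      obtain ⟨k, -, hk⟩ := Finset.mem_image.1 hβj
      have h1 := le_cuspBound m j
      have h2 := cuspBound_pos m
      right
      rw [← hk]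
      push_cast
      omega
  · refine (hB _ hβi).2 ?_
    have := h i
    rw [hNα, sub_neg_eq_add]
    exact this

variable (e) in
-- With `M = cuspBound m`, the witnesses are multiplication by `xᵢ^M`, and the lowering operator of
-- degree `-M eᵢ` whose symbol is monic of degree `M` in `θᵢ`: its exponent is `(-M + M, M)` in the
-- `i`-th pair of coordinates.
theorem exists_lead_single {N : ℕ} (t : Fin n ⊕ Fin n ≃ Fin N) (j : Fin n ⊕ Fin n) :
    ∃ u : diffOps K A, expCoeff e u (Pi.single j (cuspBound m : ℤ)) ≠ 0 ∧
      ∀ g, weightLex t (Pi.single j (cuspBound m : ℤ)) < weightLex t g → expCoeff e u g = 0 := by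
  classical
  cases j with
  | inl i =>
    let α : Fin n → ℤ := Pi.single i (cuspBound m : ℤ)
    have hα : α ∈ cuspExponents m := (cuspSingle m i 0).2
    have hf : Admissible m α (1 : MvPolynomial (Fin n) K) := fun β hβ h =>
      absurd (add_mem hβ hα) h
    have ha : Pi.single (Sum.inl i) (cuspBound m : ℤ) = mkExp α 0 := by
      funext j
      cases j with
      | inl j => by_cases hj : j = i <;> simp [mkExp, α, hj]
      | inr j => simp [mkExp]
    have h1 : ∀ δ : Fin n → ℤ, intCoeff δ (1 : MvPolynomial (Fin n) K) =
        if δ = 0 then 1 else 0 := by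
      intro δ
      have := intCoeff_monomial (K := K) (γ := δ) (le_refl (0 : Fin n → ℤ)) 1
      rwa [show natExp (0 : Fin n → ℤ) = 0 by ext; simp, ← one_def] at this
    refine ⟨cuspDiffOp e hf, ?_, fun g hg => ?_⟩
    · rw [ha, expCoeff_cuspDiffOp, degPart_mkExp, if_pos rfl, polPart_mkExp, h1, if_pos rfl]
      exact one_ne_zero
    · by_contra hne
      rw [expCoeff_cuspDiffOp, h1] at hne
      by_cases hd : degPart g = α
      · by_cases hp : polPart g = 0
        · rw [ha, ← hd, ← hp, mkExp_degPart_polPart] at hg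
          exact lt_irrefl _ hg
        · rw [if_neg hp, ite_self] at hne
          exact hne rfl
      · rw [if_neg hd] at hne
        exact hne rfl
  | inr i =>
    let M := cuspBound m
    have hf := admissible_lowerPoly (K := K) i (le_cuspBound m i)
    have ha : Pi.single (Sum.inr i) (M : ℤ) =
        mkExp (-Pi.single i (M : ℤ)) (intExp (Finsupp.single i M)) := by
      funext j
      cases j with
      | inl j => rcases eq_or_ne j i with rfl | hj <;> simp [mkExp, *]
      | inr j => rcases eq_or_ne j i with rfl | hj <;> simp [mkExp, *]
    have hdeg : (lowerPoly K (m i) M).natDegree = M := natDegree_lowerPoly _ _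
    refine ⟨cuspDiffOp e hf, ?_, fun g hg => ?_⟩
    · rw [ha, expCoeff_cuspDiffOp, degPart_mkExp, if_pos rfl, polPart_mkExp, intCoeff_intExp,
        coeff_aeval_X, if_pos (by simp), Finsupp.single_eq_same]
      have := (lowerPoly_monic (K := K) (m i) M).coeff_natDegree
      rw [hdeg] at this
      rw [this]
      exact one_ne_zero
    · by_contra hne
      rw [expCoeff_cuspDiffOp] at hne
      by_cases hd : degPart g = -Pi.single i (cuspBound m : ℤ)
      · rw [if_pos hd] at hne
        have hp := nonneg_of_intCoeff_ne_zero hne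
        rw [intCoeff_of_nonneg hp, coeff_aeval_X] at hne
        by_cases hs : natExp (polPart g) = Finsupp.single i (natExp (polPart g) i)
        · rw [if_pos hs] at hne
          have hle := Polynomial.le_natDegree_of_ne_zero hne
          rw [hdeg] at hle
          have hgle : g ≤ Pi.single (Sum.inr i) (M : ℤ) := by
            rw [ha, ← mkExp_degPart_polPart g, hd]
            refine mkExp_le_mkExp _ ?_
            rw [← intExp_natExp hp, hs]
            refine intExp_le_intExp ?_
            rw [Finsupp.single_le_single]
            exact hle
          exact absurd ((weightLex_strictMono t).monotone hgle) (not_le.2 hg)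
        · rw [if_neg hs] at hne
          exact hne rfl
      · rw [if_neg hd] at hne
        exact hne rfl

variable (e) in
/-- The leading exponents of differential operators on a multi-cusp algebra. -/
noncomputable def cuspLeadingExponents :
    LeadingExponents K (diffOps K A) (Fin n ⊕ Fin n) (ℤ ×ₗ Lex (Fin (n + n) → ℤ)) where
  coeff := expCoeff e
  ord := weightLex finSumFinEquiv
  coeff_injective := expCoeff_injective
  finite_support := finite_expCoeff_ne_zero
  ord_injective := weightLex_injective _
  ord_lt _ _ := weightLex_lt_of_sum_lt _
  coeff_mul_of_lt _ _ _ _ hu hv _ hg :=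
    expCoeff_mul_of_lt (weightLex_injective _) (weightLex_strictMono _) hu hv hg
  coeff_mul_add _ _ _ _ hu hv :=
    expCoeff_mul_add (weightLex_injective _) (weightLex_strictMono _) hu hv
  nonneg _ _ := nonneg_of_leading _
  period := cuspBound m
  period_pos := cuspBound_pos m
  exists_single := exists_lead_single e _

end Leads

/-! ### The grading -/

section Grading

variable {K : Type*} [Field K] [CharZero K] {n : ℕ} {m : Fin n → ℕ} {A : Type*} [CommRing A]
  [Algebra K A] {e : A ≃ₐ[K] multiCuspAlgebra K m}

variable (e) in
/-- The differential operators of degree `α`. -/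
noncomputable def homogeneousDiffOps (α : Fin n → ℤ) : Submodule K (diffOps K A) :=
  ⨅ γ : {γ : Fin n → ℤ // γ ≠ α}, LinearMap.ker (symbol e γ.1)

theorem mem_homogeneousDiffOps {α : Fin n → ℤ} {u : diffOps K A} :
    u ∈ homogeneousDiffOps e α ↔ ∀ γ, γ ≠ α → symbol e γ u = 0 := by
  simp [homogeneousDiffOps]

theorem one_mem_homogeneousDiffOps : (1 : diffOps K A) ∈ homogeneousDiffOps e 0 := by
  classical
  refine mem_homogeneousDiffOps.2 fun γ hγ => symbol_eq_of_opCoeff fun β => ?_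
  change monoCoeff e (β.1 + γ) (mono e β) = _
  rw [monoCoeff_mono, if_neg (by simpa using hγ), map_zero]

theorem mul_mem_homogeneousDiffOps {α β : Fin n → ℤ} {u v : diffOps K A}
    (hu : u ∈ homogeneousDiffOps e α) (hv : v ∈ homogeneousDiffOps e β) :
    u * v ∈ homogeneousDiffOps e (α + β) := by
  rw [mem_homogeneousDiffOps] at *
  intro γ hγ
  rw [symbol_mul u v (F := {β}) (fun δ hδ => Finset.mem_singleton.2 (not_not.1 (mt (hv δ) hδ))),
    Finset.sum_singleton, hu _ fun h => hγ (by rw [← h, sub_add_cancel]), map_zero, zero_mul]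

theorem isInternal_homogeneousDiffOps : DirectSum.IsInternal (homogeneousDiffOps e) := by
  classical
  rw [DirectSum.isInternal_submodule_iff_iSupIndep_and_iSup_eq_top]
  constructor
  · intro α
    rw [Submodule.disjoint_def]
    intro u hu hu'
    rw [mem_homogeneousDiffOps] at hu
    refine ext_symbol (e := e) fun γ => ?_
    rw [map_zero]
    by_cases h : γ = α
    · subst h
      -- All components of other degrees are killed by `symbol e γ`, hence so is their sum.
      have hle : ⨆ j, ⨆ (_ : j ≠ γ), homogeneousDiffOps e j ≤ LinearMap.ker (symbol e γ) :=
        iSup₂_le fun j hj v hv => mem_homogeneousDiffOps.1 hv γ hj.symm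
      exact hle hu'
    · exact hu γ h
  · rw [eq_top_iff]
    rintro u -
    rw [eq_sum_cuspDiffOp (e := e) u (F := (finite_symbol_ne_zero (e := e) u).toFinset)
      fun α hα => by simpa using hα]
    refine Submodule.sum_mem _ fun α _ => Submodule.mem_iSup_of_mem α ?_
    refine mem_homogeneousDiffOps.2 fun γ hγ => ?_
    rw [symbol_cuspDiffOp, if_neg hγ]

variable (e) in
theorem nonempty_gradedAlgebra_homogeneousDiffOps :
    Nonempty (GradedAlgebra (homogeneousDiffOps e)) :=
  letI := isInternal_homogeneousDiffOps (e := e).chooseDecomposition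
  ⟨{ one_mem := one_mem_homogeneousDiffOps
     mul_mem := fun _ _ _ _ => mul_mem_homogeneousDiffOps }⟩

end Grading

/-! ### Euler operators and the centre -/

section Centre

variable {K : Type*} [Field K] {n : ℕ} {m : Fin n → ℕ} {A : Type*} [CommRing A]
  [Algebra K A] {e : A ≃ₐ[K] multiCuspAlgebra K m}

variable (K) in
/-- Multiplication by `a` as a differential operator. -/
noncomputable def lmulDiffOp (a : A) : diffOps K A := ⟨Algebra.lmul K A a, 0, IsDiffOp.lmul a⟩

theorem lmulDiffOp_mul (a b : A) : lmulDiffOp K (a * b) = lmulDiffOp K a * lmulDiffOp K b :=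
  Subtype.ext (map_mul (Algebra.lmul K A) a b)

theorem lmulDiffOp_one : lmulDiffOp K (1 : A) = 1 := Subtype.ext (map_one (Algebra.lmul K A))

theorem admissible_zero (m : Fin n → ℕ) (f : MvPolynomial (Fin n) K) : Admissible m 0 f :=
  fun β hβ h => absurd (by rwa [add_zero]) h

variable (e) in
/-- The diagonal operator `x^β ↦ f(β) x^β`. -/
noncomputable def diagOp (f : MvPolynomial (Fin n) K) : Module.End K A :=
  cuspOp e (admissible_zero m f)

theorem diagOp_mono (f : MvPolynomial (Fin n) K) (β : cuspExponents m) :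
    diagOp e f (mono e β) = evalInt β.1 f • mono e β := by
  have h : β.1 + 0 ∈ cuspExponents m := by rw [add_zero]; exact β.2
  rw [diagOp, cuspOp_mono _ β h]
  congr 2
  exact Subtype.ext (add_zero _)

theorem monoCoeff_diagOp (f : MvPolynomial (Fin n) K) (γ : Fin n → ℤ) (a : A) :
    monoCoeff e γ (diagOp e f a) = evalInt γ f * monoCoeff e γ a := by
  classical
  have : monoCoeff e γ ∘ₗ diagOp e f = evalInt γ f • monoCoeff e γ := by
    refine linearMap_ext_mono (e := e) fun β => ?_
    rw [LinearMap.comp_apply, diagOp_mono, map_smul, LinearMap.smul_apply, monoCoeff_mono]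
    split_ifs with h
    · rw [h]
    · simp
  exact LinearMap.congr_fun this a

/-- The Euler operator is a derivation, so its commutator with `a` is again a multiplication
operator. -/
theorem adLmul_diagOp_X (i : Fin n) (a : A) :
    adLmul (diagOp e (X i)) a = -Algebra.lmul K A (diagOp e (X i) a) := by
  have : adLmul (diagOp e (X i)) =
      -((Algebra.lmul K A).toLinearMap ∘ₗ diagOp e (X i : MvPolynomial (Fin n) K)) := by
    refine linearMap_ext_mono (e := e) fun s => linearMap_ext_mono (e := e) fun β => ?_
    change mono e s * diagOp e (X i) (mono e β) - diagOp e (X i) (mono e s * mono e β) =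
      -(diagOp e (X i) (mono e s) * mono e β)
    rw [← mono_add, diagOp_mono, diagOp_mono, diagOp_mono, mul_smul_comm, smul_mul_assoc,
      ← mono_add, ← sub_smul, ← neg_smul]
    congr 1
    simp
  exact LinearMap.congr_fun this a

variable (e) in
/-- The Euler operator of the `i`-th variable. -/
noncomputable def eulerDiffOp (i : Fin n) : diffOps K A :=
  cuspDiffOp e (admissible_zero m (X i : MvPolynomial (Fin n) K))

theorem monoCoeff_one [DecidableEq (Fin n → ℤ)] (γ : Fin n → ℤ) :
    monoCoeff e γ 1 = if γ = 0 then 1 else 0 := by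
  rw [← mono_zero (e := e), monoCoeff_mono]; rfl

variable [CharZero K]

theorem isCentral_diffOps (e : A ≃ₐ[K] multiCuspAlgebra K m) :
    Algebra.IsCentral K (diffOps K A) where
  out := by
    classical
    intro z hz
    have hcomm : ∀ u : diffOps K A, u * z = z * u := Subalgebra.mem_center_iff.1 hz
    have hzero : IsDiffOp K A 0 z.1 := fun a =>
      sub_eq_zero.2 (congrArg Subtype.val (hcomm (lmulDiffOp K a)))
    have hz1 := isDiffOp_zero_iff.1 hzero
    -- The Euler operator kills `1`, hence kills `z 1`; but it multiplies the coefficient at `γ` by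
    -- `γ i ≠ 0`.
    have hcoeff : ∀ γ, γ ≠ 0 → monoCoeff e γ (z.1 1) = 0 := by
      intro γ hγ
      obtain ⟨i, hi⟩ := Function.ne_iff.1 hγ
      have h1 : diagOp e (X i) (z.1 1) = z.1 (diagOp e (X i) 1) :=
        LinearMap.congr_fun (congrArg Subtype.val (hcomm (eulerDiffOp e i))) 1
      have h2 : diagOp e (X i) (1 : A) = 0 := by
        rw [← mono_zero (e := e), diagOp_mono]
        simp
      have h3 := monoCoeff_diagOp (e := e) (X i) γ (z.1 1)
      rw [h1, h2, map_zero, map_zero, evalInt_X] at h3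
      exact (mul_eq_zero.1 h3.symm).resolve_left (by simpa using hi)
    have ha : z.1 1 = monoCoeff e 0 (z.1 1) • 1 := by
      refine ext_monoCoeff (e := e) fun γ _ => ?_
      rw [map_smul, monoCoeff_one]
      split_ifs with h
      · rw [h]; simp
      · rw [hcoeff γ h]; simp
    refine Algebra.mem_bot.2 ⟨monoCoeff e 0 (z.1 1), Subtype.ext ?_⟩
    conv_rhs => rw [hz1, ha, map_smul, map_one (Algebra.lmul K A)]
    rfl

end Centre

/-! ### Simplicity -/

section Simple

variable {K : Type*} [Field K] {n : ℕ} {m : Fin n → ℕ} {A : Type*} [CommRing A]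
  [Algebra K A] {e : A ≃ₐ[K] multiCuspAlgebra K m}

theorem smul_mem_twoSidedIdeal {R : Type*} [Ring R] [Algebra K R] (I : TwoSidedIdeal R) (c : K)
    {x : R} (hx : x ∈ I) : c • x ∈ I := by
  rw [Algebra.smul_def]
  exact I.mul_mem_left _ _ hx

/-- Commutators with `A` stay in the ideal and lower the order. If all of them vanish, `u` is
already a multiplication. -/
theorem exists_lmulDiffOp_mem (I : TwoSidedIdeal (diffOps K A)) (k : ℕ) (u : diffOps K A)
    (hk : IsDiffOp K A k u.1) (hu : u ≠ 0) (huI : u ∈ I) :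
    ∃ a : A, a ≠ 0 ∧ lmulDiffOp K a ∈ I := by
  induction k generalizing u with
  | zero =>
    have h := isDiffOp_zero_iff.1 hk
    refine ⟨u.1 1, fun h0 => hu (Subtype.ext ?_), ?_⟩
    · rw [h, h0, map_zero]; rfl
    · convert huI using 1
      exact Subtype.ext h.symm
  | succ k ih =>
    let w : A → diffOps K A := fun a => lmulDiffOp K a * u - u * lmulDiffOp K a
    have hw : ∀ a, w a ∈ I := fun a =>
      I.sub_mem (I.mul_mem_left _ _ huI) (I.mul_mem_right _ _ huI)
    by_cases h : ∃ a, w a ≠ 0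
    · obtain ⟨a, ha⟩ := h
      exact ih (w a) (hk a) ha (hw a)
    · push Not at h
      have h0 : IsDiffOp K A 0 u.1 := fun a => congrArg Subtype.val (h a)
      exact ih u (h0.mono (Nat.zero_le k)) hu huI

theorem lmulDiffOp_smul (c : K) (a : A) : lmulDiffOp K (c • a) = c • lmulDiffOp K a :=
  Subtype.ext (map_smul (Algebra.lmul K A) c a)

/-- Applying `θᵢ - γ i` to `a` deletes the term at `γ` and keeps the one at `δ` when `δ i ≠ γ i`.
The number of terms drops until a single monomial is left. -/
theorem exists_lmulDiffOp_mono_mem [CharZero K] (I : TwoSidedIdeal (diffOps K A)) (a : A)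
    (ha : a ≠ 0) (haI : lmulDiffOp K a ∈ I) : ∃ β, lmulDiffOp K (mono e β) ∈ I := by
  classical
  induction hc : {γ | monoCoeff e γ a ≠ 0}.ncard using Nat.strong_induction_on generalizing a with
  | _ k ih =>
    obtain ⟨γ, hγ⟩ : ∃ γ, monoCoeff e γ a ≠ 0 := by
      by_contra! h
      exact ha (ext_monoCoeff (e := e) fun γ _ => by rw [h, map_zero])
    have hγS : γ ∈ cuspExponents m := by
      by_contra h
      exact hγ (monoCoeff_eq_zero h a)
    by_cases hδ : ∃ δ, δ ≠ γ ∧ monoCoeff e δ a ≠ 0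
    · obtain ⟨δ, hne, hδ⟩ := hδ
      obtain ⟨i, hi⟩ := Function.ne_iff.1 hne
      let b : A := diagOp e (X i) a - (γ i : K) • a
      have hb : ∀ η, monoCoeff e η b = ((η i : K) - γ i) * monoCoeff e η a := by
        intro η
        simp only [b, map_sub, map_smul, monoCoeff_diagOp, evalInt_X, smul_eq_mul, sub_mul]
      have hbI : lmulDiffOp K b ∈ I := by
        have : lmulDiffOp K b = eulerDiffOp e i * lmulDiffOp K a - lmulDiffOp K a * eulerDiffOp e
            i -
            (γ i : K) • lmulDiffOp K a := by
          apply Subtype.ext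
          have h := adLmul_diagOp_X (e := e) i a
          rw [adLmul_apply, eq_neg_iff_add_eq_zero, add_comm, ← eq_neg_iff_add_eq_zero,
            neg_sub] at h
          change Algebra.lmul K A (diagOp e (X i) a - (γ i : K) • a) = _
          rw [map_sub, map_smul, h]
          rfl
        rw [this]
        exact I.sub_mem (I.sub_mem (I.mul_mem_left _ _ haI) (I.mul_mem_right _ _ haI))
          (smul_mem_twoSidedIdeal I _ haI)
      refine ih _ ?_ b ?_ hbI rfl
      · rw [← hc]
        refine Set.ncard_lt_ncard ⟨fun η hη => ?_, fun hsub => ?_⟩ (finite_monoCoeff_ne_zero a)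
        · rw [Set.mem_ofPred_eq, hb] at hη
          exact right_ne_zero_of_mul hη
        · have := hsub (show γ ∈ {γ | monoCoeff e γ a ≠ 0} from hγ)
          rw [Set.mem_ofPred_eq, hb, sub_self, zero_mul] at this
          exact this rfl
      · intro h0
        have := hb δ
        rw [h0, map_zero, eq_comm, mul_eq_zero, sub_eq_zero] at this
        exact this.elim (fun h => hi (by exact_mod_cast h)) hδ
    · push Not at hδ
      have haγ : a = monoCoeff e γ a • mono e ⟨γ, hγS⟩ := by
        refine ext_monoCoeff (e := e) fun η _ => ?_
        rw [map_smul, monoCoeff_mono]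
        split_ifs with h
        · rw [h]; simp
        · rw [hδ η h]; simp
      refine ⟨⟨γ, hγS⟩, ?_⟩
      have : mono e ⟨γ, hγS⟩ = (monoCoeff e γ a)⁻¹ • a := by
        conv_rhs => rw [haγ]
        rw [map_smul, monoCoeff_mono, if_pos rfl, smul_eq_mul, mul_one, smul_smul,
          inv_mul_cancel₀ hγ, one_smul]
      rw [this, lmulDiffOp_smul]
      exact smul_mem_twoSidedIdeal I _ haI

theorem mono_mul_cuspOp_mono {α : Fin n → ℤ} {f : MvPolynomial (Fin n) K}
    (hf : Admissible m α f) (s γ t : cuspExponents m) (h : s.1 + (γ.1 + α) = t.1) :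
    mono e s * cuspOp e hf (mono e γ) = evalInt γ.1 f • mono e t := by
  by_cases hγ : γ.1 + α ∈ cuspExponents m
  · rw [cuspOp_mono hf γ hγ, mul_smul_comm, ← mono_add]
    congr 2
    exact Subtype.ext h
  · have : cuspOp e hf (mono e γ) = 0 := by
      apply e.injective
      apply Subtype.ext
      rw [coe_apply_cuspOp_mono, hf _ γ.2 hγ]
      simp
    rw [this, hf _ γ.2 hγ, mul_zero, zero_smul]

/-- The roots of the two factors differ by integers that are never zero: distinct roots of
`lowerPoly K k N` have distinct residues modulo `N`, so no two roots differ by exactly `N`. -/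
theorem isCoprime_lowerPoly_comp [CharZero K] (k N : ℕ) :
    IsCoprime (lowerPoly K k N) ((lowerPoly K k N).comp (Polynomial.X + Polynomial.C (N : K))) := by
  rw [lowerPoly, Polynomial.prod_comp]
  refine IsCoprime.prod_left fun r hr => IsCoprime.prod_right fun s hs => ?_
  rw [Finset.mem_range] at hr hs
  have h : lowerRoot k N r + N ≠ lowerRoot k N s := by
    simp only [lowerRoot]
    split_ifs <;> omega
  rw [Polynomial.sub_comp, Polynomial.X_comp, Polynomial.C_comp, add_sub_assoc, ← Polynomial.C_sub,
    ← sub_neg_eq_add, ← Polynomial.C_neg]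
  refine Polynomial.isCoprime_X_sub_C_of_isUnit_sub (IsUnit.mk0 _ ?_)
  rw [neg_sub, sub_sub_eq_add_sub, sub_ne_zero]
  exact_mod_cast h

/-- The vector with entries `N` in `T` and `0` elsewhere. -/
def boxVector (m : Fin n → ℕ) {N : ℕ} (hN : cuspBound m ≤ N) (T : Finset (Fin n)) :
    cuspExponents m :=
  ⟨fun i => if i ∈ T then (N : ℤ) else 0, mem_cuspExponents_of_le fun i => by
    by_cases h : i ∈ T
    · right; simpa [h] using hN
    · left; simp [h]⟩

theorem coe_boxVector_insert {N : ℕ} (hN : cuspBound m ≤ N) {T : Finset (Fin n)} {i : Fin n}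
    (hi : i ∉ T) :
    (boxVector m hN (insert i T)).1 = (boxVector m hN T).1 + Pi.single i (N : ℤ) := by
  funext j
  by_cases hj : j = i
  · subst hj; simp [boxVector, hi]
  · simp [boxVector, hj]

/-- On the `i`-th variable, `xᵢ^N L` and `L xᵢ^N` are `p(θᵢ)` and `p(θᵢ + N)`. The Bézout relation
combines them to `1`, so the factor `xᵢ^N` can be stripped from a monomial inside an ideal. -/
theorem lmul_boxVector [CharZero K] {N : ℕ} (hN : cuspBound m ≤ N) {T : Finset (Fin n)}
    {i : Fin n} (hi : i ∉ T) (hmN : m i ≤ N) {a b : Polynomial K}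
    (hab : a * lowerPoly K (m i) N +
      b * (lowerPoly K (m i) N).comp (Polynomial.X + Polynomial.C (N : K)) = 1) :
    Algebra.lmul K A (mono e (boxVector m hN T)) =
      Algebra.lmul K A (mono e (boxVector m hN (insert i T))) *
          cuspOp e (admissible_lowerPoly (K := K) i hmN) * diagOp e (Polynomial.aeval (X i) a) +
        cuspOp e (admissible_lowerPoly (K := K) i hmN) *
          Algebra.lmul K A (mono e (boxVector m hN (insert i T))) *
          diagOp e (Polynomial.aeval (X i) b) := by
  refine linearMap_ext_mono (e := e) fun γ => ?_
  have hvec := coe_boxVector_insert hN hi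
  have hxi : (((boxVector m hN (insert i T) + γ).1 i : ℤ) : K) = γ.1 i + N := by
    simp [boxVector, add_comm]
  generalize boxVector m hN (insert i T) = x at *
  generalize boxVector m hN T = y at *
  have h2 : (x + γ).1 + -Pi.single i (N : ℤ) = (y + γ).1 := by
    rw [AddSubmonoid.coe_add, AddSubmonoid.coe_add, hvec]
    abel
  have hmem : (x + γ).1 + -Pi.single i (N : ℤ) ∈ cuspExponents m := h2 ▸ (y + γ).2
  have h3 : (⟨_, hmem⟩ : cuspExponents m) = y + γ := Subtype.ext h2
  have h5 := congrArg (Polynomial.eval (γ.1 i : K)) hab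
  simp only [Polynomial.eval_add, Polynomial.eval_mul, Polynomial.eval_comp, Polynomial.eval_X,
    Polynomial.eval_C, Polynomial.eval_one] at h5
  simp only [LinearMap.add_apply, Module.End.mul_apply, Algebra.coe_lmul_eq_mul,
    LinearMap.mul_apply', diagOp_mono, map_smul]
  rw [mono_mul_cuspOp_mono _ x γ (y + γ) (by rw [← h2, AddSubmonoid.coe_add]; abel),
    ← mono_add, ← mono_add, cuspOp_mono _ _ hmem, h3, smul_smul, smul_smul, ← add_smul,
    evalInt_aeval_X, evalInt_aeval_X, evalInt_aeval_X, evalInt_aeval_X, hxi, h5, one_smul]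

theorem lmulDiffOp_boxVector_mem [CharZero K] (I : TwoSidedIdeal (diffOps K A)) {N : ℕ}
    (hN : cuspBound m ≤ N) (T : Finset (Fin n))
    (h : lmulDiffOp K (mono e (boxVector m hN T)) ∈ I) : (1 : diffOps K A) ∈ I := by
  induction T using Finset.induction_on with
  | empty =>
    have h0 : boxVector m hN ∅ = 0 := Subtype.ext (by funext i; simp [boxVector])
    rwa [h0, mono_zero, lmulDiffOp_one] at h
  | insert i T hi ih =>
    have hmN : m i ≤ N := (le_cuspBound m i).trans hN
    obtain ⟨a, b, hab⟩ := isCoprime_lowerPoly_comp (K := K) (m i) N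
    have key : lmulDiffOp K (mono e (boxVector m hN T)) =
        lmulDiffOp K (mono e (boxVector m hN (insert i T))) *
            cuspDiffOp e (admissible_lowerPoly (K := K) i hmN) *
            cuspDiffOp e (admissible_zero m (Polynomial.aeval (X i) a)) +
          cuspDiffOp e (admissible_lowerPoly (K := K) i hmN) *
            lmulDiffOp K (mono e (boxVector m hN (insert i T))) *
            cuspDiffOp e (admissible_zero m (Polynomial.aeval (X i) b)) :=
      Subtype.ext (lmul_boxVector hN hi hmN hab)
    refine ih ?_
    rw [key]
    exact I.add_mem (I.mul_mem_right _ _ (I.mul_mem_right _ _ h))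
      (I.mul_mem_right _ _ (I.mul_mem_left _ _ h))

theorem nontrivial_diffOps (e : A ≃ₐ[K] multiCuspAlgebra K m) : Nontrivial (diffOps K A) := by
  have : Nontrivial A := e.toEquiv.nontrivial
  refine ⟨0, 1, fun h => ?_⟩
  exact zero_ne_one (α := A) (LinearMap.congr_fun (congrArg Subtype.val h) 1)

theorem isSimpleRing_diffOps [CharZero K] (e : A ≃ₐ[K] multiCuspAlgebra K m) :
    IsSimpleRing (diffOps K A) := by
  have := nontrivial_diffOps e
  refine IsSimpleRing.of_eq_bot_or_eq_top fun I => or_iff_not_imp_left.2 fun hI => ?_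
  obtain ⟨u, huI, hu⟩ : ∃ u ∈ I, u ≠ 0 := by
    by_contra! h
    refine hI (eq_bot_iff.2 fun u hu => ?_)
    rw [h u hu]
    exact TwoSidedIdeal.zero_mem _
  obtain ⟨k, hk⟩ := u.2
  obtain ⟨a, ha, haI⟩ := exists_lmulDiffOp_mem I k u hk hu huI
  obtain ⟨β, hβ⟩ := exists_lmulDiffOp_mono_mem (e := e) I a ha haI
  rw [← TwoSidedIdeal.one_mem_iff]
  -- `N` is so large that `(N, …, N) - β` is an exponent; multiplying `x^β` by that monomial gives
  -- `x^(N, …, N)`.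
  let N : ℕ := cuspBound m + ∑ i, (β.1 i).toNat
  have hN : cuspBound m ≤ N := Nat.le_add_right _ _
  let s : cuspExponents m := ⟨fun i => N - β.1 i, mem_cuspExponents_of_le fun i => Or.inr (by
    have h1 : (β.1 i).toNat ≤ ∑ i, (β.1 i).toNat :=
      Finset.single_le_sum (f := fun i => (β.1 i).toNat) (fun _ _ => Nat.zero_le _)
        (Finset.mem_univ i)
    simp only [N]
    omega)⟩
  refine lmulDiffOp_boxVector_mem (e := e) I hN Finset.univ ?_
  have : boxVector m hN Finset.univ = s + β := by
    apply Subtype.ext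
    funext i
    simp [boxVector, s]
  rw [this, mono_add, lmulDiffOp_mul]
  exact I.mul_mem_left _ _ hβ

end Simple

/-! ### Comparison of the two descriptions of the graded components -/

section Main

variable {K : Type*} [Field K] [CharZero K] {n : ℕ}

theorem multiCuspDegree_eq (m : Fin n → ℕ) :
    multiCuspDegree K m = homogeneousDiffOps (A := multiCuspAlgebra K m) AlgEquiv.refl := by
  funext α
  ext u
  rw [mem_homogeneousDiffOps]
  constructor
  · intro h γ hγ
    refine symbol_eq_of_opCoeff fun β => ?_
    rw [map_zero]
    by_contra hne
    have hnn := nonneg_of_intCoeff_ne_zero hne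
    rw [opCoeff_apply, monoCoeff_apply, intCoeff_of_nonneg hnn] at hne
    have := h (natExp β.1) (cuspMonomial K β) support_monomial_subset
      (natExp (β.1 + γ)) (mem_support_iff.2 hne)
    refine hγ (funext fun i => ?_)
    have hi := this i
    rw [natExp_apply, natExp_apply, Int.toNat_of_nonneg (hnn i),
      Int.toNat_of_nonneg (nonneg_of_mem_cuspExponents β.2 i)] at hi
    exact add_left_cancel hi
  · intro h b a ha c hc i
    -- An element supported in `{b}` with zero coefficient at `b` is zero, so its image has no
    -- exponent `c`. Otherwise `b` is an exponent of `A(m)`, and the symbol in degree `c - b`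
    -- controls the coefficient.
    have hab : coeff b a.1 ≠ 0 := by
      intro h0
      have ha0 : a = 0 := by
        apply Subtype.ext
        refine support_eq_empty.1 ?_
        refine Finset.eq_empty_of_forall_notMem fun d hd => ?_
        have := Finset.mem_singleton.1 (ha hd)
        subst this
        exact mem_support_iff.1 hd h0
      rw [ha0, map_zero] at hc
      simp at hc
    let β : cuspExponents m := ⟨intExp b, mem_multiCuspAlgebra.1 a.2 b hab⟩
    have haβ : a = coeff b a.1 • cuspMonomial K β := by
      classical
      apply Subtype.ext
      ext d
      rw [SetLike.val_smul, coe_cuspMonomial, natExp_intExp, coeff_smul, coeff_monomial]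
      split_ifs with hbd
      · rw [← hbd]; simp
      · rw [smul_zero]
        by_contra hd
        exact hbd (Finset.mem_singleton.1 (ha (mem_support_iff.2 hd))).symm
    by_contra hne
    have hsym := h (intExp c - intExp b) fun heq => hne (by
      have := congrFun heq i
      simp only [Pi.sub_apply, intExp_apply] at this
      omega)
    have hev := evalInt_symbol (e := (AlgEquiv.refl : multiCuspAlgebra K m ≃ₐ[K] _))
      (intExp c - intExp b) u β
    rw [hsym, map_zero, opCoeff_apply, monoCoeff_apply,
      show β.1 + (intExp c - intExp b) = intExp c from add_sub_cancel _ _, intCoeff_intExp] at hev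
    refine mem_support_iff.1 hc ?_
    rw [haβ, map_smul, SetLike.val_smul, coeff_smul]
    exact (congrArg _ hev.symm).trans (smul_zero _)

end Main

/-! ### Domain and Gelfand–Kirillov dimension of `𝒟(A(m))` -/

section Properties

variable {K : Type*} [Field K] [CharZero K] {n : ℕ} {m : Fin n → ℕ} {A : Type*} [CommRing A]
  [Algebra K A]

theorem isDomain_diffOps (e : A ≃ₐ[K] multiCuspAlgebra K m) : IsDomain (diffOps K A) := by
  have := nontrivial_diffOps e
  have := (cuspLeadingExponents e).noZeroDivisors
  exact NoZeroDivisors.to_isDomain _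

theorem gkDim_diffOps (e : A ≃ₐ[K] multiCuspAlgebra K m) :
    gkDim K (diffOps K A) = ((2 * n : ℕ) : EReal) := by
  have := nontrivial_diffOps e
  rw [(cuspLeadingExponents e).gkDim_eq]
  congr 1
  simp [two_mul]

end Properties

end MultiCusp

theorem theorem1p2 (K : Type*) [Field K] [CharZero K] (n : ℕ) (m : Fin n → ℕ) :
    Algebra.IsCentral K (multiCuspDiffOps K m) ∧
    IsSimpleRing (multiCuspDiffOps K m) ∧
    Nonempty (GradedAlgebra (multiCuspDegree K m)) ∧
    Algebra.FiniteType K (multiCuspDiffOps K m) ∧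
    (IsNoetherianRing (multiCuspDiffOps K m) ∧
      IsNoetherianRing (multiCuspDiffOps K m)ᵐᵒᵖ) ∧
    IsDomain (multiCuspDiffOps K m) ∧
    gkDim K (multiCuspDiffOps K m) = ((2 * n : ℕ) : EReal) := by
  let e : multiCuspAlgebra K m ≃ₐ[K] multiCuspAlgebra K m := AlgEquiv.refl
  refine ⟨isCentral_diffOps e, isSimpleRing_diffOps e, ?_, (cuspLeadingExponents e).finiteType,
    ⟨(cuspLeadingExponents e).isNoetherianRing, (cuspLeadingExponents e).op.isNoetherianRing⟩,
    isDomain_diffOps e, gkDim_diffOps e⟩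
  rw [multiCuspDegree_eq]
  exact nonempty_gradedAlgebra_homogeneousDiffOps e
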